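/- Consider a $K$-armed bandit problem with $K\ge 2$ actions and $T$ rounds. Loss vectors $\ell_t\in[0,1]^K$ and delays $d_t\in\{0,1,2,\dots\}$ with $t+d_t\le T$ $(1\le t\le T)$ are fixed in advance; the loss of the action $A_t$ chosen in round $t$ is observed at the end of round $t+d_t$. Let $O_t=\{s<t: s+d_s\ge t\}$ be the set of rounds whose feedback is missing when $A_t$ is chosen, $\tau_t=|O_t|$, $D=\sum_{t=1}^T d_t$ and $d^\star=\max_{1\le t\le T}d_t$. The algorithm DAda-Exp3 with implicit exploration draws $A_t$, conditionally on $A_1,\dots,A_{t-1}$, from the distribution $$p_{t,i}=\frac{\exp\bigl(-\eta_t\sum_{s<t,\,s\notin O_t}\hat\ell_{s,i}\bigr)}{\sum_{j=1}^K\exp\bigl(-\eta_t\sum_{s<t,\,s\notin O_t}\hat\ell_{s,j}\bigr)},\qquad \hat\ell_{s,i}=\frac{\ell_{s,i}\,\mathbb 1\{A_s=i\}}{p_{s,i}+\gamma_s}.$$ Suppose that it is run with $$\gamma_t=\eta_t=\frac12\sqrt{\frac{3\log K}{2tK+\sum_{s=1}^t\tau_s}},$$ and let $\delta\in(0,1)$.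 Then, with probability at least $1-\delta$, for every action $A^\star\in\{1,\dots,K\}$, $$\sum_{t=1}^T\bigl(\ell_{t,A_t}-\ell_{t,A^\star}\bigr)\le 2\sqrt{3\log(K)\,(2KT+D)}+\Bigl(2\sqrt{\frac{2TK+D}{3\log K}}+d^\star+2\Bigr)\frac{\log(2/\delta)}{2}.$$ -/

import Mathlib

/-!
Adversarial `K`-armed bandits with delayed feedback and the delay-adaptive `Exp3` algorithm with
implicit exploration. Rounds are the natural numbers `1, 2, …, T`; `ℓ t i` is the loss of action `i`
in round `t` and `d t` is the delay of the feedback of round `t`. Losses and delays are fixed in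
advance (oblivious adversary).
-/

namespace DelayedBandit

/-- `O_t`: the rounds `s < t` whose feedback is still missing when the decision of round `t` is
made. -/
def missing (d : ℕ → ℕ) (t : ℕ) : Finset ℕ :=
  (Finset.Ico 1 t).filter fun s => t ≤ s + d s

/-- `τ_t = |O_t|`. -/
def numMissing (d : ℕ → ℕ) (t : ℕ) : ℕ :=
  (missing d t).card

/-- The cumulative delay `D = d_1 + … + d_T`. -/
def cumDelay (T : ℕ) (d : ℕ → ℕ) : ℕ :=
  ∑ t ∈ Finset.Icc 1 T, d t

/-- The maximum delay `d^* = max_{1 ≤ t ≤ T} d_t`. -/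
def maxDelay (T : ℕ) (d : ℕ → ℕ) : ℕ :=
  (Finset.Icc 1 T).sup d

/-- The distribution `p_t` chosen by the algorithm in round `t`, as a function of the realised
actions `a`: exponential weights, with step size `η t`, on the sum of those loss estimates
`ℓ s j · 1{a s = j} / (p_s j + γ s)`, `s < t`, whose feedback has arrived. -/
noncomputable def prob {K : ℕ} (η γ : ℕ → ℝ) (d : ℕ → ℕ) (ℓ : ℕ → Fin K → ℝ)
    (a : ℕ → Fin K) (t : ℕ) (i : Fin K) : ℝ :=
  let S : Fin K → ℝ := fun j =>
    ∑ s : {s : ℕ // s ∈ Finset.Ico 1 t \ missing d t},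
      ℓ s.1 j * (if a s.1 = j then 1 else 0) / (prob η γ d ℓ a s.1 j + γ s.1)
  Real.exp (-(η t * S i)) / ∑ j, Real.exp (-(η t * S j))
termination_by t
decreasing_by
  exact (Finset.mem_Ico.1 (Finset.mem_sdiff.1 s.2).1).2

/-- The implicit-exploration loss estimate. -/
noncomputable def lossEst {K : ℕ} (η γ : ℕ → ℝ) (d : ℕ → ℕ) (ℓ : ℕ → Fin K → ℝ)
    (a : ℕ → Fin K) (t : ℕ) (i : Fin K) : ℝ :=
  ℓ t i * (if a t = i then 1 else 0) / (prob η γ d ℓ a t i + γ t)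

/-- `L̂_t`: the sum of all loss estimates of rounds before `t`. -/
noncomputable def cumEst {K : ℕ} (η γ : ℕ → ℝ) (d : ℕ → ℕ) (ℓ : ℕ → Fin K → ℝ)
    (a : ℕ → Fin K) (t : ℕ) (i : Fin K) : ℝ :=
  ∑ s ∈ Finset.Ico 1 t, lossEst η γ d ℓ a s i

/-- `Δ̂_t`: the sum of the missing loss estimates. -/
noncomputable def missingEst {K : ℕ} (η γ : ℕ → ℝ) (d : ℕ → ℕ) (ℓ : ℕ → Fin K → ℝ)
    (a : ℕ → Fin K) (t : ℕ) (i : Fin K) : ℝ :=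
  ∑ s ∈ missing d t, lossEst η γ d ℓ a s i

/-- The recursively defined `p_t` satisfies the defining equation of the algorithm. -/
theorem prob_eq {K : ℕ} (η γ : ℕ → ℝ) (d : ℕ → ℕ) (ℓ : ℕ → Fin K → ℝ)
    (a : ℕ → Fin K) (t : ℕ) (i : Fin K) :
    prob η γ d ℓ a t i =
      Real.exp (-(η t * (cumEst η γ d ℓ a t i - missingEst η γ d ℓ a t i))) /
        ∑ j, Real.exp (-(η t * (cumEst η γ d ℓ a t j - missingEst η γ d ℓ a t j))) := by
  have key : ∀ j : Fin K,
      (∑ s : {s : ℕ // s ∈ Finset.Ico 1 t \ missing d t},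
        ℓ s.1 j * (if a s.1 = j then 1 else 0) / (prob η γ d ℓ a s.1 j + γ s.1)) =
      cumEst η γ d ℓ a t j - missingEst η γ d ℓ a t j := by
    intro j
    rw [eq_sub_iff_add_eq]
    unfold cumEst missingEst
    rw [← Finset.sum_sdiff (Finset.filter_subset (fun s => t ≤ s + d s) (Finset.Ico 1 t))]
    congr 1
    exact Finset.sum_coe_sort (Finset.Ico 1 t \ missing d t) (fun s => lossEst η γ d ℓ a s j)
  rw [prob]
  simp only [key]

/-- The actions `A_1, …, A_T` are generated by the algorithm with step sizes `η` and exploration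
parameters `γ`: given the actions of the previous rounds, `A_t` has distribution `p_t`. -/
structure IsDAdaExp3 {K : ℕ} {Ω : Type*} [MeasurableSpace Ω] (T : ℕ) (η γ : ℕ → ℝ)
    (d : ℕ → ℕ) (ℓ : ℕ → Fin K → ℝ) (μ : MeasureTheory.Measure Ω) (A : ℕ → Ω → Fin K) :
    Prop where
  measurable : ∀ t ∈ Finset.Icc 1 T, Measurable (A t)
  law : ∀ t ∈ Finset.Icc 1 T, ∀ a : ℕ → Fin K,
    μ {ω | ∀ s ∈ Finset.Icc 1 t, A s ω = a s} =
      μ {ω | ∀ s ∈ Finset.Ico 1 t, A s ω = a s} * ENNReal.ofReal (prob η γ d ℓ a t (a t))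

/-- The step size `η_t = ½ √(3 log K / (2 t K + τ_1 + … + τ_t))`. -/
noncomputable def stepSize (K : ℕ) (d : ℕ → ℕ) (t : ℕ) : ℝ :=
  1 / 2 * √(3 * Real.log K / (2 * t * K + ∑ s ∈ Finset.Icc 1 t, (numMissing d s : ℝ)))

end DelayedBandit

/-! The regret splits into three parts (`regret_le`). The exponential potential contributes `log K /
η_T`. The second part is the sum of estimates minus losses of the comparator. The third is
`roundExcess`, the loss incurred in a round minus the growth of the potential.

The comparator part has an exponential supermartingale (`sum_prod_exp_lossEst_le`), followed by a
union bound over the `K` actions.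

Delay enters through the excess. With `h_r = ℓ_{r,A_r} / (p_{r,A_r} + η_r)`, the excess of round `t`
is at most `η_t` times the sum of the `h_r` over missing rounds `r` with `A_r = A_t`, plus `(3/2)
η_t h_t` (`loss_sub_potential_le`). Its mean is at most `η_t (τ_t + 3K/2)`. Since it couples `A_t`
with the actions of the missing rounds, conditioning round by round does not bound its exponential
moment.

Instead that moment is expanded over link patterns (`sum_prod_exp_le`). A round is plain, or a root
that puts the coefficient `w_t` on `h_r` for the missing `r` sharing its action, or it is linked to
a later root whose action it must copy. Linked rounds no longer carry a probability, and the
distribution of a root depends only on earlier unlinked rounds. So for each pattern the actions can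
be summed out, and the sum over patterns is bounded by a deterministic product.

The expansion rests on `p * exp (a h) ≤ p + a` for `a ≤ 2γ` (`mul_exp_le_add`), the effect of
implicit exploration. As a round is missing at most `d^*` times, this permits the exponent `lam = 2
/ (d^* + 2)`. Each link costs an extra factor `exp lam`, which raises `τ_t` by at most `2`. This
fits into the spare `K / 2` between `3K/2` and `2K` if `K ≥ 4`. For `K = 2, 3` a slight damping of
the drift makes up the difference (`damped_mass_le`). Markov's inequality and the sum of the step
sizes finish the proof. -/

namespace DelayedBandit

/-! ### Sums of adapted products over finite product spaces. -/

section AdaptedSums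

variable {ι α κ : Type*} [Fintype ι] [DecidableEq ι] [Fintype α]

theorem sum_sum_update (s : ι) (F : (ι → α) → ℝ) :
    ∑ a : ι → α, ∑ x, F (Function.update a s x) = Fintype.card α * ∑ a, F a := by
  have hinv : Function.Involutive
      (fun q : (ι → α) × α => (Function.update q.1 s q.2, q.1 s)) := by
    rintro ⟨a, x⟩
    simp
  calc ∑ a : ι → α, ∑ x, F (Function.update a s x)
      = ∑ q : (ι → α) × α, F (Function.update q.1 s q.2) := by
        rw [Fintype.sum_prod_type]
    _ = ∑ q : (ι → α) × α, F q.1 :=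
        Equiv.sum_comp hinv.toPerm (fun q : (ι → α) × α => F q.1)
    _ = Fintype.card α * ∑ a, F a := by
        rw [Fintype.sum_prod_type]
        simp [Finset.mul_sum]

/-- The sum over one coordinate of an adapted product factors out. -/
theorem card_mul_sum_prod_insert (g : ι → (ι → α) → ℝ) {s : ι} {S : Finset ι} (hs : s ∉ S)
    (hdep : ∀ t ∈ S, ∀ a x, g t (Function.update a s x) = g t a) :
    Fintype.card α * ∑ a : ι → α, ∏ t ∈ insert s S, g t a =
      ∑ a : ι → α, (∑ x, g s (Function.update a s x)) * ∏ t ∈ S, g t a := by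
  rw [← sum_sum_update s]
  refine Finset.sum_congr rfl fun a _ => ?_
  rw [Finset.sum_mul]
  refine Finset.sum_congr rfl fun x _ => ?_
  rw [Finset.prod_insert hs, Finset.prod_congr rfl fun t ht => hdep t ht a x]

variable [Nonempty α] [LinearOrder κ] (key : ι → κ) (g : ι → (ι → α) → ℝ) (M : ι → ℝ)

/-- Iterated conditional expectation along an arbitrary `key`: the coordinate of largest key enters
no other factor, so it is summed out first. The order need not be time; below it is also reversed
time and a lexicographic order. -/
theorem sum_prod_adapted_le (hg : ∀ t a, 0 ≤ g t a)
    (hdep : ∀ t s, t ≠ s → key t ≤ key s → ∀ a x, g t (Function.update a s x) = g t a)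
    (hsum : ∀ t a, ∑ x, g t (Function.update a t x) ≤ M t) :
    ∑ a : ι → α, ∏ t, g t a ≤ ∏ t, M t := by
  have hM : ∀ t, 0 ≤ M t := fun t => by
    obtain ⟨x₀⟩ := ‹Nonempty α›
    exact (Finset.sum_nonneg fun x _ => hg t _).trans (hsum t fun _ => x₀)
  have hc : (0 : ℝ) < Fintype.card α := by exact_mod_cast Fintype.card_pos
  -- The sum always runs over all coordinates; the powers of `card α` account for those not
  -- constrained by `S`.
  have main : ∀ S : Finset ι, (Fintype.card α : ℝ) ^ S.card * ∑ a : ι → α, ∏ t ∈ S, g t a ≤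
      (∏ t ∈ S, M t) * (Fintype.card α : ℝ) ^ Fintype.card ι := by
    intro S
    induction S using Finset.induction_on_max_value key with
    | empty => simp
    | insert s S hs hmax ih =>
      have hd : ∀ t ∈ S, ∀ a x, g t (Function.update a s x) = g t a := fun t ht =>
        hdep t s (fun h => hs (h ▸ ht)) (hmax t ht)
      rw [Finset.card_insert_of_notMem hs, pow_succ, mul_assoc, card_mul_sum_prod_insert g hs hd,
        Finset.prod_insert hs, mul_assoc]
      refine le_trans ?_ (mul_le_mul_of_nonneg_left ih (hM s))
      rw [← mul_assoc, mul_comm (M s), mul_assoc]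
      simp only [Finset.mul_sum]
      refine Finset.sum_le_sum fun a _ => mul_le_mul_of_nonneg_left ?_ (pow_nonneg hc.le _)
      exact mul_le_mul_of_nonneg_right (hsum s a) (Finset.prod_nonneg fun t _ => hg t a)
  have h := main Finset.univ
  rw [Finset.card_univ, mul_comm] at h
  exact le_of_mul_le_mul_right h (by positivity)

theorem le_sum_prod_adapted (hg : ∀ t a, 0 ≤ g t a) (hM : ∀ t, 0 ≤ M t)
    (hdep : ∀ t s, t ≠ s → key t ≤ key s → ∀ a x, g t (Function.update a s x) = g t a)
    (hsum : ∀ t a, M t ≤ ∑ x, g t (Function.update a t x)) :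
    ∏ t, M t ≤ ∑ a : ι → α, ∏ t, g t a := by
  have hc : (0 : ℝ) < Fintype.card α := by exact_mod_cast Fintype.card_pos
  have main : ∀ S : Finset ι, (∏ t ∈ S, M t) * (Fintype.card α : ℝ) ^ Fintype.card ι ≤
      (Fintype.card α : ℝ) ^ S.card * ∑ a : ι → α, ∏ t ∈ S, g t a := by
    intro S
    induction S using Finset.induction_on_max_value key with
    | empty => simp
    | insert s S hs hmax ih =>
      have hd : ∀ t ∈ S, ∀ a x, g t (Function.update a s x) = g t a := fun t ht =>
        hdep t s (fun h => hs (h ▸ ht)) (hmax t ht)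
      rw [Finset.card_insert_of_notMem hs, pow_succ, mul_assoc, card_mul_sum_prod_insert g hs hd,
        Finset.prod_insert hs, mul_assoc]
      refine le_trans (mul_le_mul_of_nonneg_left ih (hM s)) ?_
      rw [← mul_assoc, mul_comm (M s), mul_assoc]
      simp only [Finset.mul_sum]
      refine Finset.sum_le_sum fun a _ => mul_le_mul_of_nonneg_left ?_ (pow_nonneg hc.le _)
      exact mul_le_mul_of_nonneg_right (hsum s a) (Finset.prod_nonneg fun t _ => hg t a)
  have h := main Finset.univ
  rw [Finset.card_univ, mul_comm (_ ^ _)] at h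
  exact le_of_mul_le_mul_right h (by positivity)

end AdaptedSums


/-! ### Expansion of the exponential moment over link patterns. -/

section DelayedExpansion

variable {ι α : Type*} [LinearOrder ι] [DecidableEq α]

/-- The weight of the option `c t` of round `t` in the expansion of a product of exponential
weights: `none` is a round into which no later expansion links, `some t` a round which may be the
target of links, and `some s` with `s ≠ t` a link of `t` to the later round `s`. -/
noncomputable def linkWeight (O : ι → Finset ι) (p σ : ι → (ι → α) → α → ℝ) (w u : ι → ℝ) (E : ℝ)
    (t : ι) (c : ι → Option ι) (a : ι → α) : ℝ :=
  (c t).elim (p t a (a t) * (1 - σ t a (a t))) fun s =>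
    (if s = t then p t a (a t) * σ t a (a t) + u t else 0) +
      (if t ∈ O s ∧ c s = some s ∧ a s = a t then E * w s else 0)

/-- The total mass of `linkWeight` over the actions of round `t`. -/
noncomputable def linkMass (O : ι → Finset ι) (β w V : ι → ℝ) (E : ℝ) (t : ι)
    (c : ι → Option ι) : ℝ :=
  (c t).elim (1 - β t) fun s =>
    (if s = t then β t + V t else 0) + (if t ∈ O s ∧ c s = some s then E * w s else 0)

variable {O : ι → Finset ι} {p σ : ι → (ι → α) → α → ℝ} {β w u V : ι → ℝ} {E : ℝ}

theorem linkWeight_nonneg (hp : ∀ t a i, 0 ≤ p t a i) (hσ0 : ∀ t a i, 0 ≤ σ t a i)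
    (hσ1 : ∀ t a i, σ t a i ≤ 1) (hw : ∀ t, 0 ≤ w t) (hu : ∀ t, 0 ≤ u t) (hE : 0 ≤ E)
    (t : ι) (c : ι → Option ι) (a : ι → α) : 0 ≤ linkWeight O p σ w u E t c a := by
  unfold linkWeight
  cases c t with
  | none => exact mul_nonneg (hp _ _ _) (sub_nonneg.2 (hσ1 _ _ _))
  | some s =>
    refine add_nonneg ?_ ?_ <;> split_ifs
    · exact add_nonneg (mul_nonneg (hp _ _ _) (hσ0 _ _ _)) (hu _)
    · rfl
    · exact mul_nonneg hE (hw _)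
    · rfl

theorem linkMass_nonneg (hβ0 : ∀ t, 0 ≤ β t) (hβ1 : ∀ t, β t ≤ 1) (hw : ∀ t, 0 ≤ w t)
    (hV : ∀ t, 0 ≤ V t) (hE : 0 ≤ E) (t : ι) (c : ι → Option ι) :
    0 ≤ linkMass O β w V E t c := by
  unfold linkMass
  cases c t with
  | none => exact sub_nonneg.2 (hβ1 _)
  | some s =>
    refine add_nonneg ?_ ?_ <;> split_ifs
    · exact add_nonneg (hβ0 _) (hV _)
    · rfl
    · exact mul_nonneg hE (hw _)
    · rfl

variable [Fintype ι]

/-- What roots hand out to their missing rounds equals what those rounds collect. This cancellation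
removes the auxiliary exponentials in both expansions below. -/
theorem link_swap (c : ι → Option ι) (f : ι → ι → ℝ) :
    ∑ t, (if c t = some t then ∑ r ∈ O t, f r t else 0) =
      ∑ r, ∑ s, (if r ∈ O s ∧ c s = some s then f r s else 0) := by
  rw [Finset.sum_comm]
  refine Finset.sum_congr rfl fun t _ => ?_
  by_cases h : c t = some t
  · simp [h, Finset.sum_ite_mem]
  · simp [h]

/-- Pathwise expansion of a product of exponential weights. -/
theorem prod_le_sum_prod_linkWeight (hO : ∀ t, ∀ r ∈ O t, r < t)
    (hp : ∀ t a i, 0 ≤ p t a i) (hσ0 : ∀ t a i, 0 ≤ σ t a i)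
    (hσ1 : ∀ t a i, σ t a i ≤ 1) (hw : ∀ t, 0 ≤ w t) (hu : ∀ t, 0 ≤ u t) (hE : 0 ≤ E)
    (h R : ι → (ι → α) → ℝ)
    (hR : ∀ t a C, 0 ≤ C → C ≤ ∑ s, (if t ∈ O s then w s else 0) →
      p t a (a t) * Real.exp (R t a + C * h t a) ≤ p t a (a t) * (1 - σ t a (a t)) +
        (p t a (a t) * σ t a (a t) + u t) *
          Real.exp (∑ r ∈ O t, if a t = a r then w t * h r a else 0) + E * C)
    (a : ι → α) :
    ∏ t, p t a (a t) * Real.exp (R t a) ≤ ∑ c, ∏ t, linkWeight O p σ w u E t c a := by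
  let C : ι → (ι → Option ι) → ℝ := fun t c =>
    ∑ s, if t ∈ O s ∧ c s = some s then (if a s = a t then w s else 0) else 0
  let X : ι → ℝ := fun t => ∑ r ∈ O t, if a t = a r then w t * h r a else 0
  -- A root pays `exp (X t)`, and every round divides out the coefficient of `h t` collected from
  -- later roots with the same action. These factors cancel over all rounds, but with them the sum
  -- over `c t` alone already dominates the factor of round `t`.
  let g : ι → (ι → Option ι) → ℝ := fun t c =>
    linkWeight O p σ w u E t c a * Real.exp ((if c t = some t then X t else 0) - C t c * h t a)
  have hg : ∀ c, ∏ t, g t c = ∏ t, linkWeight O p σ w u E t c a := by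
    intro c
    simp only [g]
    rw [Finset.prod_mul_distrib, ← Real.exp_sum, Finset.sum_sub_distrib, link_swap]
    have : ∑ r, ∑ s, (if r ∈ O s ∧ c s = some s then
        (if a s = a r then w s * h r a else 0) else 0) = ∑ t, C t c * h t a := by
      refine Finset.sum_congr rfl fun r _ => ?_
      simp only [C, Finset.sum_mul]
      refine Finset.sum_congr rfl fun s _ => ?_
      split_ifs <;> simp
    rw [this, sub_self, Real.exp_zero, mul_one]
  have hCdep : ∀ t s, s ≤ t → ∀ c x, C t (Function.update c s x) = C t c := by
    intro t s hst c x
    refine Finset.sum_congr rfl fun s' _ => ?_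
    by_cases hs' : t ∈ O s'
    · rw [Function.update_of_ne ((hst.trans_lt (hO _ _ hs')).ne')]
    · simp [hs']
  have hC0 : ∀ t c, 0 ≤ C t c := fun t c => Finset.sum_nonneg fun s _ => by
    split_ifs <;> first | exact hw s | rfl
  have hC1 : ∀ t c, C t c ≤ ∑ s, (if t ∈ O s then w s else 0) := fun t c =>
    Finset.sum_le_sum fun s _ => by
      by_cases h1 : t ∈ O s <;> simp only [h1, true_and, false_and, if_true, if_false, le_refl]
      split_ifs <;> first | exact hw s | rfl
  -- Time is reversed because `C t` is determined by the options of later rounds.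
  have key := le_sum_prod_adapted (α := Option ι) (OrderDual.toDual : ι → ιᵒᵈ) g
    (fun t => p t a (a t) * Real.exp (R t a))
    (fun t c => mul_nonneg (linkWeight_nonneg hp hσ0 hσ1 hw hu hE t c a) (Real.exp_pos _).le)
    (fun t => mul_nonneg (hp _ _ _) (Real.exp_pos _).le) ?_ ?_
  · simpa only [hg] using key
  · intro t s hts hle c x
    have hst : s ≤ t := hle
    simp only [g, linkWeight]
    rw [hCdep t s hst, Function.update_of_ne hts]
    congr 2
    funext s'
    congr 1
    by_cases hs' : t ∈ O s'
    · rw [Function.update_of_ne ((hst.trans_lt (hO _ _ hs')).ne')]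
    · simp [hs']
  · intro t c
    have e1 : ∀ x, g t (Function.update c t x) = x.elim (p t a (a t) * (1 - σ t a (a t)))
        (fun s => (if s = t then (p t a (a t) * σ t a (a t) + u t) * Real.exp (X t) else 0) +
          E * (if t ∈ O s ∧ c s = some s then (if a s = a t then w s else 0) else 0)) *
        Real.exp (-(C t c * h t a)) := by
      intro x
      simp only [g, linkWeight]
      rw [hCdep t t le_rfl, Function.update_self]
      cases x with
      | none => simp
      | some s =>
        simp only [Option.elim_some, Option.some.injEq]
        by_cases hst : s = t
        · subst hst
          have : s ∉ O s := fun hh => lt_irrefl _ (hO _ _ hh)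
          simp only [this, if_true, false_and, if_false, sub_eq_add_neg, Real.exp_add]
          ring
        · rw [Function.update_of_ne hst]
          simp only [hst, if_false, zero_add, zero_sub]
          by_cases h1 : t ∈ O s <;> by_cases h2 : c s = some s <;> by_cases h3 : a s = a t <;>
            simp [h1, h2, h3]
    have e2 : ∑ x, g t (Function.update c t x) = (p t a (a t) * (1 - σ t a (a t)) +
        (p t a (a t) * σ t a (a t) + u t) * Real.exp (X t) + E * C t c) *
        Real.exp (-(C t c * h t a)) := by
      simp only [e1]
      rw [← Finset.sum_mul, Fintype.sum_option]
      simp only [Option.elim_none, Option.elim_some]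
      rw [Finset.sum_add_distrib, ← Finset.mul_sum, Finset.sum_ite_eq' Finset.univ t]
      simp only [Finset.mem_univ, if_true, C]
      ring
    rw [e2]
    have h1 := hR t a (C t c) (hC0 t c) (hC1 t c)
    calc p t a (a t) * Real.exp (R t a)
        = p t a (a t) * Real.exp (R t a + C t c * h t a) * Real.exp (-(C t c * h t a)) := by
          rw [mul_assoc, ← Real.exp_add]; ring_nf
      _ ≤ _ := mul_le_mul_of_nonneg_right h1 (Real.exp_pos _).le

variable [Fintype α]

/-- For a fixed choice of links, the sum over the actions is at most the product of the masses. -/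
theorem sum_prod_linkWeight_le [Nonempty α] (hO : ∀ t, ∀ r ∈ O t, r < t)
    (hO' : ∀ r s t, r ∈ O t → r < s → s ≤ t → r ∈ O s)
    (hp : ∀ t a i, 0 ≤ p t a i) (hp1 : ∀ t a, ∑ i, p t a i = 1)
    (hpdep : ∀ t a b, (∀ r < t, r ∉ O t → a r = b r) → p t a = p t b)
    (hσdep : ∀ t a b, (∀ r < t, r ∉ O t → a r = b r) → σ t a = σ t b)
    (hσ0 : ∀ t a i, 0 ≤ σ t a i) (hσ1 : ∀ t a i, σ t a i ≤ 1)
    (hβ : ∀ t a, ∑ i, p t a i * σ t a i = β t)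
    (hw : ∀ t, 0 ≤ w t) (hu : ∀ t, 0 ≤ u t) (hE : 0 ≤ E) (c : ι → Option ι) :
    ∑ a, ∏ t, linkWeight O p σ w u E t c a ≤
      ∏ t, linkMass O β w (fun t => Fintype.card α * u t) E t c := by
  have hβ0 : ∀ t, 0 ≤ β t := fun t => by
    obtain ⟨i⟩ := ‹Nonempty α›
    exact (hβ t fun _ => i) ▸ Finset.sum_nonneg fun i _ => mul_nonneg (hp _ _ _) (hσ0 _ _ _)
  have hβ1 : ∀ t, β t ≤ 1 := fun t => by
    obtain ⟨i⟩ := ‹Nonempty α›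
    rw [← hβ t fun _ => i, ← hp1 t fun _ => i]
    exact Finset.sum_le_sum fun j _ => mul_le_of_le_one_right (hp _ _ _) (hσ1 _ _ _)
  have hmass := linkMass_nonneg (O := O) (V := fun t => Fintype.card α * u t) hβ0 hβ1 hw
    (fun t => mul_nonneg (Nat.cast_nonneg _) (hu t)) hE
  -- A pattern with a link that does not end at an admissible root has weight zero.
  by_cases hval : ∀ t s, c t = some s → s = t ∨ (t ∈ O s ∧ c s = some s)
  swap
  · push Not at hval
    obtain ⟨t, s, hts, hne, hns⟩ := hval
    have : ∀ a, ∏ t, linkWeight O p σ w u E t c a = 0 := fun a => by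
      refine Finset.prod_eq_zero (Finset.mem_univ t) ?_
      simp only [linkWeight, hts, Option.elim_some, hne, if_false, zero_add]
      rw [if_neg]
      rintro ⟨h1, h2, -⟩
      exact hns h1 h2
    simp only [this, Finset.sum_const_zero]
    exact Finset.prod_nonneg fun t _ => hmass t c
  -- `π` sends a linked round to its root and fixes all others.
  let π : ι → ι := fun t => (c t).getD t
  have hπ : ∀ t, π t ≠ t → c t = some (π t) ∧ t ∈ O (π t) ∧ c (π t) = some (π t) := by
    intro t ht
    cases hc : c t with
    | none => exact absurd (by simp [π, hc]) ht
    | some s =>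
      have hs : π t = s := by simp [π, hc]
      rw [hs] at ht ⊢
      exact ⟨rfl, (hval t s hc).resolve_left ht⟩
  have hππ : ∀ t, π (π t) = π t := by
    intro t
    by_cases ht : π t = t
    · rw [ht, ht]
    · simp [π, (hπ t ht).2.2]
  -- Where linked actions copy their roots, `a ∘ π = a`; elsewhere the link weight vanishes.
  -- Evaluating at `a ∘ π` frees the distributions from the linked coordinates.
  let g : ι → (ι → α) → ℝ := fun t a =>
    (c t).elim (p t (a ∘ π) (a t) * (1 - σ t (a ∘ π) (a t))) fun s =>
      if s = t then p t (a ∘ π) (a t) * σ t (a ∘ π) (a t) + u t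
      else if a s = a t then E * w s else 0
  have hg0 : ∀ t a, 0 ≤ g t a := by
    intro t a
    simp only [g]
    cases c t with
    | none => exact mul_nonneg (hp _ _ _) (sub_nonneg.2 (hσ1 _ _ _))
    | some s =>
      dsimp only [Option.elim_some]
      split_ifs
      · exact add_nonneg (mul_nonneg (hp _ _ _) (hσ0 _ _ _)) (hu _)
      · exact mul_nonneg hE (hw _)
      · rfl
  have hle : ∀ a, ∏ t, linkWeight O p σ w u E t c a ≤ ∏ t, g t a := by
    intro a
    by_cases ha : ∀ t, a (π t) = a t
    · have haπ : a ∘ π = a := funext ha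
      refine le_of_eq (Finset.prod_congr rfl fun t _ => ?_)
      simp only [linkWeight, g, haπ]
      cases hc : c t with
      | none => rfl
      | some s =>
        simp only [Option.elim_some]
        rcases hval t s hc with rfl | ⟨h1, h2⟩
        · have : s ∉ O s := fun hh => lt_irrefl _ (hO _ _ hh)
          simp [this]
        · have hne : s ≠ t := fun hh => lt_irrefl _ (hh ▸ hO _ _ h1)
          simp [hne, h1, h2]
    · push Not at ha
      obtain ⟨t, ht⟩ := ha
      have hne : π t ≠ t := fun hh => ht (by rw [hh])
      refine le_trans (le_of_eq (Finset.prod_eq_zero (Finset.mem_univ t) ?_))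
        (Finset.prod_nonneg fun t _ => hg0 t a)
      simp [linkWeight, (hπ t hne).1, hne, ht]
  refine (Finset.sum_le_sum fun a _ => hle a).trans ?_
  have hroot : ∀ t s, π t = t → (t ≤ π s) → t ≠ s → ∀ (a : ι → α) (x : α),
      ∀ r < t, r ∉ O t → (Function.update a s x ∘ π) r = (a ∘ π) r := by
    intro t s htt hts hne a x r hr hrO
    simp only [Function.comp]
    refine Function.update_of_ne (fun hrs => ?_) _ _
    have hs : π s = s := hrs ▸ hππ r
    have hlt : t < s := lt_of_le_of_ne (hs ▸ hts) hne
    have hrne : π r ≠ r := fun hh => by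
      rw [hh] at hrs; exact absurd (hrs ▸ hr) (not_lt.2 hlt.le)
    -- A round `r < t` linked to a root after `t` is still missing at `t`, hence invisible to the
    -- distribution of round `t`.
    exact hrO (hO' r t s (hrs ▸ (hπ r hrne).2.1) hr hlt.le)
  -- Rounds linked to a root are summed out just before the root itself, and roots from last to
  -- first.
  refine sum_prod_adapted_le (fun t => toLex (π t, if π t = t then 0 else 1) : ι → ι ×ₗ ℕ)
    g _ hg0 ?_ ?_
  · intro t s hts hle a x
    rw [Prod.Lex.toLex_le_toLex] at hle
    simp only at hle
    have hle1 : π t ≤ π s := by rcases hle with h | h; exacts [h.le, h.1.le]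
    by_cases htt : π t = t
    · have hd := hroot t s htt (htt ▸ hle1) hts a x
      simp only [g]
      rw [hpdep t _ _ hd, hσdep t _ _ hd, Function.update_of_ne hts]
      cases hc : c t with
      | none => rfl
      | some s' =>
        have : s' = t := by simpa [π, hc] using htt
        simp [this]
    · have hc := (hπ t htt).1
      have hs : π t ≠ s := by
        rintro rfl
        rw [hππ t] at hle
        simp [htt] at hle
      simp [g, hc, htt, Function.update_of_ne hts, Function.update_of_ne hs]
  · intro t a
    by_cases htt : π t = t
    · have hd : ∀ x, ∀ r < t, r ∉ O t → (Function.update a t x ∘ π) r = (a ∘ π) r := by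
        intro x r hr hrO
        simp only [Function.comp]
        refine Function.update_of_ne (fun hrs => ?_) _ _
        have hrne : π r ≠ r := fun hh => hr.ne (hh ▸ hrs)
        exact hrO (hrs ▸ (hπ r hrne).2.1)
      have hpd := fun x => hpdep t _ _ (hd x)
      have hσd := fun x => hσdep t _ _ (hd x)
      simp only [g, linkMass, hpd, hσd, Function.update_self]
      cases hc : c t with
      | none =>
        simp only [Option.elim_none, mul_sub, mul_one]
        rw [Finset.sum_sub_distrib, hp1, hβ]
      | some s' =>
        have hs' : s' = t := by simpa [π, hc] using htt
        subst hs'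
        have : s' ∉ O s' := fun hh => lt_irrefl _ (hO _ _ hh)
        simp only [Option.elim_some, if_true, this, false_and, if_false, add_zero]
        rw [Finset.sum_add_distrib, hβ]
        simp
    · obtain ⟨h1, h2, h3⟩ := hπ t htt
      simp [g, linkMass, h1, htt, h2, h3]

/-- A root pays `E * w t` in advance for each round of `O t`, and a round collects `Z t`. With `M`
the mass of the options other than links, `M ≥ 1` gives `M + Z ≤ M * exp Z`, and payments cancel
against collections. -/
theorem sum_prod_linkMass_le (hO : ∀ t, ∀ r ∈ O t, r < t) (hβ0 : ∀ t, 0 ≤ β t)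
    (hβ1 : ∀ t, β t ≤ 1) (hw : ∀ t, 0 ≤ w t) (hV : ∀ t, 0 ≤ V t) (hE : 0 ≤ E) :
    ∑ c, ∏ t, linkMass O β w V E t c ≤
      ∏ t, (1 - β t + (β t + V t) * Real.exp ((O t).card * (E * w t))) := by
  let Z : ι → (ι → Option ι) → ℝ := fun t c =>
    ∑ s, if t ∈ O s ∧ c s = some s then E * w s else 0
  let g : ι → (ι → Option ι) → ℝ := fun t c => linkMass O β w V E t c *
    Real.exp ((if c t = some t then ∑ r ∈ O t, E * w t else 0) - Z t c)
  have hg : ∀ c, ∏ t, g t c = ∏ t, linkMass O β w V E t c := by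
    intro c
    simp only [g]
    rw [Finset.prod_mul_distrib, ← Real.exp_sum, Finset.sum_sub_distrib, link_swap]
    simp [Z]
  have hZdep : ∀ t s, s ≤ t → ∀ c x, Z t (Function.update c s x) = Z t c := by
    intro t s hst c x
    refine Finset.sum_congr rfl fun s' _ => ?_
    by_cases hs' : t ∈ O s'
    · rw [Function.update_of_ne ((hst.trans_lt (hO _ _ hs')).ne')]
    · simp [hs']
  have hZ0 : ∀ t c, 0 ≤ Z t c := fun t c => Finset.sum_nonneg fun s _ => by
    split_ifs <;> first | exact mul_nonneg hE (hw s) | rfl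
  rw [← Finset.sum_congr rfl fun c _ => hg c]
  refine sum_prod_adapted_le (α := Option ι) (OrderDual.toDual : ι → ιᵒᵈ) g _
    (fun t c => mul_nonneg (linkMass_nonneg hβ0 hβ1 hw hV hE t c) (Real.exp_pos _).le) ?_ ?_
  · intro t s hts hle c x
    have hst : s ≤ t := hle
    simp only [g, linkMass]
    rw [hZdep t s hst, Function.update_of_ne hts]
    congr 2
    funext s'
    congr 1
    by_cases hs' : t ∈ O s'
    · rw [Function.update_of_ne ((hst.trans_lt (hO _ _ hs')).ne')]
    · simp [hs']
  · intro t c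
    set B := Real.exp ((O t).card * (E * w t)) with hB
    have e1 : ∀ x, g t (Function.update c t x) = x.elim (1 - β t)
        (fun s => (if s = t then (β t + V t) * B else 0) +
          (if t ∈ O s ∧ c s = some s then E * w s else 0)) * Real.exp (-Z t c) := by
      intro x
      simp only [g, linkMass]
      rw [hZdep t t le_rfl, Function.update_self]
      cases x with
      | none => simp
      | some s =>
        simp only [Option.elim_some, Option.some.injEq]
        by_cases hst : s = t
        · subst hst
          have : s ∉ O s := fun hh => lt_irrefl _ (hO _ _ hh)
          simp only [this, if_true, false_and, if_false, sub_eq_add_neg, Real.exp_add, hB,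
            Finset.sum_const, nsmul_eq_mul]
          ring
        · rw [Function.update_of_ne hst]
          simp [hst]
    have e2 : ∑ x, g t (Function.update c t x) =
        (1 - β t + (β t + V t) * B + Z t c) * Real.exp (-Z t c) := by
      simp only [e1]
      rw [← Finset.sum_mul, Fintype.sum_option]
      simp only [Option.elim_none, Option.elim_some]
      rw [Finset.sum_add_distrib, Finset.sum_ite_eq' Finset.univ t]
      simp only [Finset.mem_univ, if_true, Z]
      ring
    rw [e2]
    have hB1 : 1 ≤ B := Real.one_le_exp (mul_nonneg (Nat.cast_nonneg _) (mul_nonneg hE (hw t)))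
    have hM : 1 ≤ 1 - β t + (β t + V t) * B := by
      nlinarith [mul_nonneg (add_nonneg (hβ0 t) (hV t)) (sub_nonneg.2 hB1), hV t]
    have h1 : 1 - β t + (β t + V t) * B + Z t c ≤
        (1 - β t + (β t + V t) * B) * Real.exp (Z t c) := by
      nlinarith [Real.add_one_le_exp (Z t c), mul_nonneg (sub_nonneg.2 hM) (hZ0 t c)]
    calc _ ≤ (1 - β t + (β t + V t) * B) * Real.exp (Z t c) * Real.exp (-Z t c) :=
          mul_le_mul_of_nonneg_right h1 (Real.exp_pos _).le
      _ = _ := by rw [mul_assoc, ← Real.exp_add]; simp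

/-- Exponential moment bound for an adapted sequence of actions whose distributions depend on the
past only through the rounds outside `O t`, when the exponents couple each round `t` with the
rounds in `O t`. -/
theorem sum_prod_exp_le [Nonempty α] (hO : ∀ t, ∀ r ∈ O t, r < t)
    (hO' : ∀ r s t, r ∈ O t → r < s → s ≤ t → r ∈ O s)
    (hp : ∀ t a i, 0 ≤ p t a i) (hp1 : ∀ t a, ∑ i, p t a i = 1)
    (hpdep : ∀ t a b, (∀ r < t, r ∉ O t → a r = b r) → p t a = p t b)
    (hσdep : ∀ t a b, (∀ r < t, r ∉ O t → a r = b r) → σ t a = σ t b)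
    (hσ0 : ∀ t a i, 0 ≤ σ t a i) (hσ1 : ∀ t a i, σ t a i ≤ 1)
    (hβ : ∀ t a, ∑ i, p t a i * σ t a i = β t)
    (hw : ∀ t, 0 ≤ w t) (hu : ∀ t, 0 ≤ u t) (hE : 0 ≤ E)
    (h R : ι → (ι → α) → ℝ)
    (hR : ∀ t a C, 0 ≤ C → C ≤ ∑ s, (if t ∈ O s then w s else 0) →
      p t a (a t) * Real.exp (R t a + C * h t a) ≤ p t a (a t) * (1 - σ t a (a t)) +
        (p t a (a t) * σ t a (a t) + u t) *
          Real.exp (∑ r ∈ O t, if a t = a r then w t * h r a else 0) + E * C) :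
    ∑ a, ∏ t, p t a (a t) * Real.exp (R t a) ≤
      ∏ t, (1 - β t + (β t + Fintype.card α * u t) * Real.exp ((O t).card * (E * w t))) := by
  have hβ0 : ∀ t, 0 ≤ β t := fun t => by
    obtain ⟨i⟩ := ‹Nonempty α›
    exact (hβ t fun _ => i) ▸ Finset.sum_nonneg fun i _ => mul_nonneg (hp _ _ _) (hσ0 _ _ _)
  have hβ1 : ∀ t, β t ≤ 1 := fun t => by
    obtain ⟨i⟩ := ‹Nonempty α›
    rw [← hβ t fun _ => i, ← hp1 t fun _ => i]
    exact Finset.sum_le_sum fun j _ => mul_le_of_le_one_right (hp _ _ _) (hσ1 _ _ _)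
  calc _ ≤ ∑ a, ∑ c, ∏ t, linkWeight O p σ w u E t c a := Finset.sum_le_sum fun a _ =>
        prod_le_sum_prod_linkWeight hO hp hσ0 hσ1 hw hu hE h R hR a
    _ = ∑ c, ∑ a, ∏ t, linkWeight O p σ w u E t c a := Finset.sum_comm
    _ ≤ ∑ c, ∏ t, linkMass O β w (fun t => Fintype.card α * u t) E t c :=
        Finset.sum_le_sum fun c _ =>
          sum_prod_linkWeight_le hO hO' hp hp1 hpdep hσdep hσ0 hσ1 hβ hw hu hE c
    _ ≤ _ := sum_prod_linkMass_le hO hβ0 hβ1 hw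
        (fun t => mul_nonneg (Nat.cast_nonneg _) (hu t)) hE

end DelayedExpansion


/-! ### Scalar inequalities for a single round. -/

section Inequalities

theorem exp_neg_le_quadratic {x : ℝ} (hx : 0 ≤ x) : Real.exp (-x) ≤ 1 - x + x ^ 2 / 2 := by
  have h1 := Real.quadratic_le_exp_of_nonneg hx
  rw [Real.exp_neg]
  refine inv_le_of_inv_le₀ (by nlinarith [sq_nonneg (x - 1)]) ?_
  refine le_trans ?_ h1
  rw [inv_le_iff_one_le_mul₀ (by nlinarith [sq_nonneg (x - 1)])]
  nlinarith [sq_nonneg (x ^ 2)]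

/-- The exponential bound for implicit exploration estimates. -/
theorem mul_exp_le_add {p γ a h : ℝ} (hp : 0 ≤ p) (hγ : 0 < γ) (ha : 0 ≤ a) (haγ : a ≤ 2 * γ)
    (hh : h ≤ 1 / (p + γ)) : p * Real.exp (a * h) ≤ p + a := by
  rcases hp.eq_or_lt with rfl | hp
  · simpa using ha
  have h1 : a * h ≤ Real.log (1 + a / p) := by
    calc a * h ≤ a * (1 / (p + γ)) := mul_le_mul_of_nonneg_left hh ha
      -- After clearing denominators this is `a ≤ 2 * γ`, multiplied by `a`.
      _ ≤ 2 * (a / p) / (a / p + 2) := by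
        rw [mul_one_div, div_le_div_iff₀ (by positivity) (by positivity)]
        field_simp
        nlinarith
      _ ≤ _ := Real.le_log_one_add_of_nonneg (by positivity)
  calc p * Real.exp (a * h) ≤ p * (1 + a / p) := by
        refine mul_le_mul_of_nonneg_left ?_ hp.le
        rw [← Real.exp_log (show 0 < 1 + a / p by positivity)]
        exact Real.exp_le_exp.2 h1
    _ = p + a := by field_simp

/-- The exponent `lam * R` is bounded both by `σ * X + u * h` and by `lam`; the case split picks the
bound according to the smaller of `σ * X` and `lam`. Hence `C` is multiplied by `exp lam` only and
never by `exp X`, so linked rounds pass no weight on. -/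
theorem mul_exp_le_expansion {p γ σ u C h X lam R : ℝ} (hp : 0 ≤ p) (hγ : 0 < γ) (hσ0 : 0 ≤ σ)
    (hσ1 : σ ≤ 1) (hu : 0 ≤ u) (hC : 0 ≤ C) (huC : u + C ≤ 2 * γ)
    (hh1 : h ≤ 1 / (p + γ)) (hX : 0 ≤ X) (hlam : 0 ≤ lam) (hR1 : R ≤ 1)
    (hR : lam * R ≤ σ * X + u * h) :
    p * Real.exp (lam * R + C * h) ≤
      p * (1 - σ) + (p * σ + u) * Real.exp X + Real.exp lam * C := by
  have hconv : Real.exp (σ * X) ≤ 1 - σ + σ * Real.exp X := by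
    have := convexOn_exp.2 (Set.mem_univ (0 : ℝ)) (Set.mem_univ X) (sub_nonneg.2 hσ1) hσ0
      (by ring)
    simpa using this
  have hσX : Real.exp (σ * X) ≤ Real.exp X :=
    Real.exp_le_exp.2 (mul_le_of_le_one_left hX hσ1)
  have hpc := mul_le_mul_of_nonneg_left hconv hp
  rcases le_total (σ * X) lam with hle | hle
  · have h1 : p * Real.exp (lam * R + C * h) ≤ Real.exp (σ * X) * (p + (u + C)) := by
      calc p * Real.exp (lam * R + C * h)
          ≤ p * Real.exp (σ * X + (u + C) * h) := by
            refine mul_le_mul_of_nonneg_left (Real.exp_le_exp.2 ?_) hp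
            linarith
        _ = Real.exp (σ * X) * (p * Real.exp ((u + C) * h)) := by rw [Real.exp_add]; ring
        _ ≤ _ := mul_le_mul_of_nonneg_left
            (mul_exp_le_add hp hγ (add_nonneg hu hC) huC hh1) (Real.exp_pos _).le
    have h2 := mul_le_mul_of_nonneg_left hσX hu
    have h3 := mul_le_mul_of_nonneg_left (Real.exp_le_exp.2 hle) hC
    linarith
  · have h1 : p * Real.exp (lam * R + C * h) ≤ Real.exp lam * (p + C) := by
      calc p * Real.exp (lam * R + C * h)
          ≤ p * Real.exp (lam + C * h) := by
            refine mul_le_mul_of_nonneg_left (Real.exp_le_exp.2 ?_) hp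
            nlinarith
        _ = Real.exp lam * (p * Real.exp (C * h)) := by rw [Real.exp_add]; ring
        _ ≤ _ := mul_le_mul_of_nonneg_left
            (mul_exp_le_add hp hγ hC (by linarith) hh1) (Real.exp_pos _).le
    have h2 := mul_nonneg hu (Real.exp_pos X).le
    have h3 := mul_le_mul_of_nonneg_left (Real.exp_le_exp.2 hle) hp
    linarith

theorem two_mul_exp_sub_one_le {x : ℝ} (hx : 0 ≤ x) :
    2 * (Real.exp x - 1) ≤ x * (Real.exp x + 1) := by
  have h1 : 0 ≤ Real.exp x - 1 := sub_nonneg.2 (Real.one_le_exp hx)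
  have h2 := Real.le_log_one_add_of_nonneg h1
  rw [show 1 + (Real.exp x - 1) = Real.exp x by ring, Real.log_exp,
    div_le_iff₀ (by linarith)] at h2
  linarith

/-- The relative change of a probability `p` when its weight is multiplied by `exp (-x)`. -/
theorem one_sub_inv_le {p ζ x : ℝ} (hp1 : p ≤ 1) (hζp : ζ ≤ p)
    (hζ2 : ζ ≤ 1 / 2) (hx : 0 ≤ x) :
    1 - ((1 - p) * Real.exp x + p)⁻¹ ≤ (1 - ζ) * x := by
  have he : 1 ≤ Real.exp x := Real.one_le_exp hx
  have hg : 1 ≤ (1 - p) * Real.exp x + p := by nlinarith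
  have hg' : (1 - p) * Real.exp x + p ≤ (1 - ζ) * Real.exp x + ζ := by nlinarith
  have h0 : 0 < (1 - ζ) * Real.exp x + ζ := by linarith
  calc 1 - ((1 - p) * Real.exp x + p)⁻¹ ≤ 1 - ((1 - ζ) * Real.exp x + ζ)⁻¹ := by
        have := inv_anti₀ (by linarith) hg'
        linarith
    -- With `G = (1 - ζ) * exp x + ζ`, one has `G - 1 = (1 - ζ) * (exp x - 1)`, while `ζ ≤ 1 / 2`
    -- gives `(exp x + 1) / 2 ≤ G`.
    _ ≤ (1 - ζ) * x := by
        have h1 := two_mul_exp_sub_one_le hx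
        have h2 : x * (Real.exp x + 1) ≤ 2 * (x * ((1 - ζ) * Real.exp x + ζ)) := by
          nlinarith [mul_nonneg (mul_nonneg hx (sub_nonneg.2 hζ2)) (sub_nonneg.2 he)]
        have h3 : (1 - ζ) * Real.exp x + ζ - 1 ≤
            (1 - ζ) * x * ((1 - ζ) * Real.exp x + ζ) := by
          nlinarith [mul_le_mul_of_nonneg_left (h1.trans h2)
            (show (0 : ℝ) ≤ (1 - ζ) / 2 by linarith)]
        rw [← div_le_iff₀ h0] at h3
        rwa [sub_div, div_self h0.ne', one_div] at h3

end Inequalities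

/-! ### The exponential potential and the one-round regret bound. -/

section Potential

variable {α : Type*} [Fintype α] [Nonempty α]

/-- The exponential potential `-η⁻¹ log (average of exp (-η L))`. -/
noncomputable def potential (η : ℝ) (L : α → ℝ) : ℝ :=
  -(Real.log ((∑ j, Real.exp (-(η * L j))) / Fintype.card α) / η)

theorem potential_zero (η : ℝ) : potential η (fun _ : α => 0) = 0 := by
  have : (Fintype.card α : ℝ) ≠ 0 := by exact_mod_cast Fintype.card_ne_zero
  simp [potential, this]

theorem potential_le {η : ℝ} (hη : 0 < η) (L : α → ℝ) (i : α) :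
    potential η L ≤ L i + Real.log (Fintype.card α) / η := by
  have hc : (0 : ℝ) < Fintype.card α := by exact_mod_cast Fintype.card_pos
  have h1 : Real.exp (-(η * L i)) ≤ ∑ j, Real.exp (-(η * L j)) :=
    Finset.single_le_sum (f := fun j => Real.exp (-(η * L j)))
      (fun j _ => (Real.exp_pos _).le) (Finset.mem_univ i)
  have hpos := (Real.exp_pos _).trans_le h1
  have h2 := Real.log_le_log (Real.exp_pos _) h1
  rw [Real.log_exp] at h2
  unfold potential
  rw [Real.log_div hpos.ne' hc.ne', ← neg_div, div_le_iff₀ hη, add_mul, div_mul_cancel₀ _ hη.ne']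
  linarith

/-- `exp (-potential)` is the power mean of order `η` of `exp (-L)`. With decreasing step sizes the
increments therefore telescope up to a favourable sign. -/
theorem potential_antitone {η η' : ℝ} (hη' : 0 < η') (h : η' ≤ η) (L : α → ℝ) :
    potential η L ≤ potential η' L := by
  have hη : 0 < η := hη'.trans_le h
  have hc : (0 : ℝ) < Fintype.card α := by exact_mod_cast Fintype.card_pos
  have hpos : ∀ e : ℝ, 0 < (∑ j, Real.exp (-(e * L j))) / Fintype.card α := fun e =>
    div_pos (Finset.sum_pos (fun j _ => Real.exp_pos _) Finset.univ_nonempty) hc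
  have hj := Real.rpow_arith_mean_le_arith_mean_rpow Finset.univ
    (fun _ : α => (Fintype.card α : ℝ)⁻¹) (fun j => Real.exp (-(η' * L j)))
    (fun _ _ => by positivity) (by simp [hc.ne']) (fun _ _ => (Real.exp_pos _).le)
    ((one_le_div hη').2 h)
  have e1 : ∀ j, Real.exp (-(η' * L j)) ^ (η / η') = Real.exp (-(η * L j)) := fun j => by
    rw [← Real.exp_mul]
    congr 1
    field_simp
  simp only [e1, ← Finset.mul_sum] at hj
  rw [inv_mul_eq_div, inv_mul_eq_div] at hj
  have h2 := Real.log_le_log (Real.rpow_pos_of_pos (hpos η') _) hj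
  rw [Real.log_rpow (hpos η')] at h2
  unfold potential
  rw [neg_le_neg_iff, le_div_iff₀ hη]
  calc _ = η / η' * Real.log ((∑ j, Real.exp (-(η' * L j))) / Fintype.card α) := by
        field_simp
    _ ≤ _ := h2

theorem sum_potential_sub_le {T : ℕ} (hT : 1 ≤ T) {η : ℕ → ℝ} (hη : ∀ t, 1 ≤ t → 0 < η t)
    (hmono : ∀ t, 1 ≤ t → η (t + 1) ≤ η t) (L : ℕ → α → ℝ) (hL : L 1 = fun _ => 0) :
    ∑ t ∈ Finset.Icc 1 T, (potential (η t) (L (t + 1)) - potential (η t) (L t)) ≤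
      potential (η T) (L (T + 1)) := by
  induction T, hT using Nat.le_induction with
  | base => simp [hL, potential_zero]
  | succ n hn ih =>
    rw [Finset.sum_Icc_succ_top (by omega)]
    have := potential_antitone (hη (n + 1) (by omega)) (hmono n hn) (L (n + 1))
    linarith

theorem potential_mono {η : ℝ} (hη : 0 < η) {L L' : α → ℝ} (h : ∀ i, L i ≤ L' i) :
    potential η L ≤ potential η L' := by
  have hc : (0 : ℝ) < Fintype.card α := by exact_mod_cast Fintype.card_pos
  unfold potential
  have : (0:ℝ) < ∑ j, Real.exp (-(η * L' j)) :=
    Finset.sum_pos (fun j _ => Real.exp_pos _) Finset.univ_nonempty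
  have h2 : ∑ j, Real.exp (-(η * L' j)) ≤ ∑ j, Real.exp (-(η * L j)) :=
    Finset.sum_le_sum fun j _ => Real.exp_le_exp.2
      (neg_le_neg (mul_le_mul_of_nonneg_left (h j) hη.le))
  gcongr

variable [DecidableEq α]

/-- The growth of the potential caused by an increase of a single coordinate. -/
theorem le_potential_add_sub {η : ℝ} (hη : 0 < η) (L : α → ℝ) (A : α) (h : ℝ) :
    Real.exp (-(η * L A)) / (∑ j, Real.exp (-(η * L j))) * (1 - Real.exp (-(η * h))) / η ≤
      potential η (fun i => L i + if A = i then h else 0) - potential η L := by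
  have hc : (0 : ℝ) < Fintype.card α := by exact_mod_cast Fintype.card_pos
  set W := ∑ j, Real.exp (-(η * L j)) with hW
  have hWpos : 0 < W := Finset.sum_pos (fun j _ => Real.exp_pos _) Finset.univ_nonempty
  set W' := ∑ j, Real.exp (-(η * (L j + if A = j then h else 0))) with hW'
  have hW'pos : 0 < W' := Finset.sum_pos (fun j _ => Real.exp_pos _) Finset.univ_nonempty
  have e1 : W' = W - Real.exp (-(η * L A)) * (1 - Real.exp (-(η * h))) := by
    have : ∀ j, Real.exp (-(η * (L j + if A = j then h else 0))) = Real.exp (-(η * L j)) -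
        if A = j then Real.exp (-(η * L A)) * (1 - Real.exp (-(η * h))) else 0 := by
      intro j
      split_ifs with hj
      · subst hj
        rw [mul_add, neg_add, Real.exp_add]
        ring
      · simp
    rw [hW', Finset.sum_congr rfl fun j _ => this j, Finset.sum_sub_distrib,
      Finset.sum_ite_eq Finset.univ A]
    simp [hW]
  have h1 := Real.log_le_sub_one_of_pos (div_pos hW'pos hWpos)
  rw [Real.log_div hW'pos.ne' hWpos.ne', e1, sub_div, div_self hWpos.ne', ← e1] at h1
  unfold potential
  rw [← hW, ← hW', Real.log_div hW'pos.ne' hc.ne', Real.log_div hWpos.ne' hc.ne',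
    neg_sub_neg, ← sub_div]
  refine div_le_div_of_nonneg_right ?_ hη.le
  rw [div_mul_eq_mul_div]
  linarith

/-- Comparison of exponential weights on `L` with those on `L - Δ`. -/
theorem weights_ge {η : ℝ} (hη : 0 < η) (L Δ : α → ℝ) (hΔ : ∀ i, 0 ≤ Δ i) (A : α) {p : ℝ}
    (hp : p = Real.exp (-(η * (L A - Δ A))) / ∑ j, Real.exp (-(η * (L j - Δ j)))) :
    p * ((1 - p) * Real.exp (η * Δ A) + p)⁻¹ ≤
      Real.exp (-(η * L A)) / ∑ j, Real.exp (-(η * L j)) := by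
  set b : α → ℝ := fun j => Real.exp (-(η * (L j - Δ j))) with hb
  have hbpos : ∀ j, 0 < b j := fun j => Real.exp_pos _
  set Z := ∑ j, b j with hZ
  have hZpos : 0 < Z := Finset.sum_pos (fun j _ => hbpos j) Finset.univ_nonempty
  have hAZ : b A ≤ Z := Finset.single_le_sum (fun j _ => (hbpos j).le) (Finset.mem_univ A)
  have hLb : ∀ j, Real.exp (-(η * L j)) = b j * Real.exp (-(η * Δ j)) := fun j => by
    rw [hb, ← Real.exp_add]; ring_nf
  -- Restoring the missing losses of the other actions can only raise the probability of `A`, so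
  -- only `Δ A` matters.
  have hsum : ∑ j, Real.exp (-(η * L j)) ≤ Z - b A + Real.exp (-(η * L A)) := by
    rw [hZ, ← Finset.add_sum_erase _ _ (Finset.mem_univ A),
      ← Finset.add_sum_erase Finset.univ b (Finset.mem_univ A)]
    have : ∑ j ∈ Finset.univ.erase A, Real.exp (-(η * L j)) ≤
        ∑ j ∈ Finset.univ.erase A, b j := Finset.sum_le_sum fun j _ => by
      rw [hLb]
      exact mul_le_of_le_one_right (hbpos j).le
        (Real.exp_le_one_iff.2 (neg_nonpos.2 (mul_nonneg hη.le (hΔ j))))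
    linarith
  have hpos : 0 < ∑ j, Real.exp (-(η * L j)) :=
    Finset.sum_pos (fun j _ => Real.exp_pos _) Finset.univ_nonempty
  have hp' : p = b A / Z := hp
  have e1 : p * ((1 - p) * Real.exp (η * Δ A) + p)⁻¹ =
      Real.exp (-(η * L A)) / (Z - b A + Real.exp (-(η * L A))) := by
    have h0 : 0 < (Z - b A) * Real.exp (η * Δ A) + b A :=
      add_pos_of_nonneg_of_pos (mul_nonneg (sub_nonneg.2 hAZ) (Real.exp_pos _).le) (hbpos A)
    have h1 : 0 < Z - b A + b A * (Real.exp (η * Δ A))⁻¹ :=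
      add_pos_of_nonneg_of_pos (sub_nonneg.2 hAZ)
        (mul_pos (hbpos A) (inv_pos.2 (Real.exp_pos _)))
    rw [hLb, Real.exp_neg, hp']
    have h2 := Real.exp_pos (η * Δ A)
    have h3 : (1 - b A / Z) * Real.exp (η * Δ A) + b A / Z =
        ((Z - b A) * Real.exp (η * Δ A) + b A) / Z := by field_simp
    rw [h3, inv_div]
    field_simp
  rw [e1]
  exact div_le_div_of_nonneg_left (Real.exp_pos _).le hpos hsum

/-- The regret of one round against the growth of the potential. -/
theorem loss_sub_potential_le {η : ℝ} (hη : 0 < η) (L Δ : α → ℝ) (hΔ : ∀ i, 0 ≤ Δ i) (A : α)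
    {p ζ l h : ℝ} (hl0 : 0 ≤ l) (hl1 : l ≤ 1)
    (hp : p = Real.exp (-(η * (L A - Δ A))) / ∑ j, Real.exp (-(η * (L j - Δ j))))
    (hζp : ζ ≤ p) (hζ2 : ζ ≤ 1 / 2) (hh : h = l / (p + η)) :
    l - (potential η (fun i => L i + if A = i then h else 0) - potential η L) ≤
      (1 - ζ) * (η * Δ A) + 3 / 2 * (η * h) := by
  have hZpos : 0 < ∑ j, Real.exp (-(η * (L j - Δ j))) :=
    Finset.sum_pos (fun j _ => Real.exp_pos _) Finset.univ_nonempty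
  have hp0 : 0 ≤ p := by rw [hp]; positivity
  have hp1 : p ≤ 1 := by
    rw [hp]
    exact div_le_one_of_le₀ (Finset.single_le_sum
      (f := fun j => Real.exp (-(η * (L j - Δ j)))) (fun j _ => (Real.exp_pos _).le)
      (Finset.mem_univ A)) hZpos.le
  have hx : 0 ≤ η * Δ A := mul_nonneg hη.le (hΔ A)
  have hpη : 0 < p + η := by linarith
  have hh0 : 0 ≤ h := by rw [hh]; positivity
  -- In `l = p * h + η * h` the bias of implicit exploration gives one `η * h`; the second-order
  -- term of `exp (-(η * h))` gives the other half of the constant `3 / 2`.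
  have hlh : l = (p + η) * h := by rw [hh, mul_div_cancel₀ _ hpη.ne']
  have hy0 : 0 ≤ η * h := mul_nonneg hη.le hh0
  have hph : p * h ≤ 1 := by nlinarith
  have hph0 : 0 ≤ p * h := mul_nonneg hp0 hh0
  have hy1 : η * h ≤ 1 := by nlinarith
  have hw := weights_ge hη L Δ hΔ A hp
  have hpot := le_potential_add_sub hη L A h
  have hf := one_sub_inv_le hp1 hζp hζ2 hx
  set g := ((1 - p) * Real.exp (η * Δ A) + p)⁻¹ with hg
  have hg1 : g ≤ 1 := inv_le_one_of_one_le₀ (by nlinarith [Real.one_le_exp hx])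
  have hg0 : 0 ≤ g := inv_nonneg.2 (by nlinarith [Real.one_le_exp hx])
  have hv : η * h * (1 - η * h / 2) ≤ 1 - Real.exp (-(η * h)) := by
    nlinarith [exp_neg_le_quadratic hy0]
  have hmix : p * g * (h * (1 - η * h / 2)) ≤
      Real.exp (-(η * L A)) / (∑ j, Real.exp (-(η * L j))) * (1 - Real.exp (-(η * h))) / η := by
    rw [le_div_iff₀ hη]
    calc p * g * (h * (1 - η * h / 2)) * η = p * g * (η * h * (1 - η * h / 2)) := by ring
      _ ≤ _ := mul_le_mul hw hv (mul_nonneg hy0 (by linarith))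
          (hw.trans' (mul_nonneg hp0 hg0))
  have h1 : p * h * (1 - g * (1 - η * h / 2)) ≤ (1 - g) + η * h / 2 := by
    have h2 : 1 - g * (1 - η * h / 2) ≤ (1 - g) + η * h / 2 := by nlinarith
    have h3 : 0 ≤ 1 - g * (1 - η * h / 2) := by nlinarith
    nlinarith
  nlinarith

end Potential


/-! ### Damping of the drift for two or three actions. -/

section Damping

/-- The probability with which links into a round may be neglected. It is only needed when `K` is
too small for the crude bound to hold. -/
noncomputable def damping (K d τ : ℕ) : ℝ :=
  if Real.exp (2 / (d + 2)) * τ ≤ τ + K / 2 then 0 else 1 / (K : ℝ) ^ 2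

theorem damping_nonneg (K d τ : ℕ) : 0 ≤ damping K d τ := by
  unfold damping
  split_ifs <;> positivity

theorem damping_le (K d τ : ℕ) : damping K d τ ≤ 1 / (K : ℝ) ^ 2 := by
  unfold damping
  split_ifs <;> first | positivity | rfl

theorem exp_two_div_mul_le {d τ : ℕ} (h : τ ≤ d) : Real.exp (2 / (d + 2)) * τ ≤ τ + 2 := by
  rcases Nat.eq_zero_or_pos d with rfl | hd
  · obtain rfl : τ = 0 := by omega
    norm_num
  have hd' : (0 : ℝ) < d := by exact_mod_cast hd
  have h1 : Real.exp (2 / ((d : ℝ) + 2)) ≤ (d + 2) / d := by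
    have h2 := Real.one_sub_le_exp_neg (2 / ((d : ℝ) + 2))
    rw [Real.exp_neg] at h2
    have h3 : (1 : ℝ) - 2 / (d + 2) = d / (d + 2) := by field_simp; ring
    rw [h3] at h2
    have h4 := inv_anti₀ (by positivity) h2
    rwa [inv_inv, inv_div] at h4
  have hτ : (τ : ℝ) ≤ d := by exact_mod_cast h
  calc Real.exp (2 / (d + 2)) * τ ≤ (d + 2) / d * τ :=
        mul_le_mul_of_nonneg_right h1 (Nat.cast_nonneg _)
    _ = τ + 2 * (τ / d) := by field_simp
    _ ≤ τ + 2 := by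
        have : (τ : ℝ) / d ≤ 1 := div_le_one_of_le₀ hτ hd'.le
        linarith

theorem exp_half_le : Real.exp (1 / 2) ≤ 7 / 4 := by
  have h : Real.exp (1 / 2) ^ 2 = Real.exp 1 := by rw [← Real.exp_nat_mul]; norm_num
  nlinarith [Real.exp_one_lt_d9, Real.exp_pos (1 / 2)]

theorem exp_two_thirds_le : Real.exp (2 / 3) ≤ 2 := by
  have h : Real.exp (2 / 3) ^ 3 = Real.exp 1 ^ 2 := by
    rw [← Real.exp_nat_mul, ← Real.exp_nat_mul]; norm_num
  have h1 : Real.exp 1 ^ 2 ≤ 2 ^ 3 := by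
    nlinarith [Real.exp_one_lt_d9, Real.exp_pos 1]
  exact le_of_pow_le_pow_left₀ (by norm_num) (by norm_num) (h ▸ h1)

/-- If the crude bound fails then `K` is `2` or `3` and `τ` is at least `K`. -/
theorem small_of_crude_bound_fails {K d τ : ℕ} (hK : 2 ≤ K) (hτ : τ ≤ d)
    (h : ¬ Real.exp (2 / (d + 2)) * τ ≤ τ + K / 2) : (K = 2 ∧ 2 ≤ τ) ∨ (K = 3 ∧ 3 ≤ τ) := by
  have hK4 : K < 4 := by
    by_contra! h4
    have : (4 : ℝ) ≤ K := by exact_mod_cast h4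
    exact h ((exp_two_div_mul_le hτ).trans (by linarith))
  have hK2 : (2 : ℝ) ≤ K := by exact_mod_cast hK
  have hmono : ∀ n : ℕ, n ≤ d →
      Real.exp (2 / ((d : ℝ) + 2)) ≤ Real.exp (2 / ((n : ℝ) + 2)) := by
    intro n hn
    have : (n : ℝ) ≤ d := by exact_mod_cast hn
    gcongr
  have h0 : τ ≠ 0 := by
    rintro rfl
    refine h ?_
    simp only [Nat.cast_zero, mul_zero, zero_add]
    linarith
  have h1 : τ ≠ 1 := by
    rintro rfl
    refine h ?_
    have h2 := (hmono 1 hτ).trans (by norm_num; exact exp_two_thirds_le)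
    norm_num at h2 ⊢
    linarith
  rcases (show K = 2 ∨ K = 3 by omega) with rfl | rfl
  · left; omega
  · right
    refine ⟨rfl, ?_⟩
    have h2 : τ ≠ 2 := by
      rintro rfl
      refine h ?_
      have h2 := hmono 2 hτ
      rw [show (2 : ℝ) / ((2 : ℕ) + 2) = 1 / 2 by norm_num] at h2
      have h3 := h2.trans exp_half_le
      norm_num at h2 ⊢
      linarith
    omega

/-- The case `K = 2`, with `1 / 4 = 1 / K ^ 2`, `3 * z = K * (3 / 2 * z)` and `s = τ + 2`. To first
order in `z` it says `3 / 4 * s + 3 ≤ s + 2`, which is exactly `4 ≤ s`. -/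
theorem damped_exp_le_two {s z : ℝ} (hs : 4 ≤ s) (hz : 0 ≤ z) :
    1 / 4 + (3 / 4 + 3 * z) * Real.exp (s * z) ≤ Real.exp ((s + 2) * z) := by
  have h1 := Real.quadratic_le_exp_of_nonneg (show 0 ≤ 2 * z by linarith)
  have h2 := exp_neg_le_quadratic (show 0 ≤ 4 * z by linarith)
  have h3 : Real.exp (-(s * z)) ≤ Real.exp (-(4 * z)) :=
    Real.exp_le_exp.2 (by nlinarith)
  have h4 : 1 / 4 * Real.exp (-(s * z)) + (3 / 4 + 3 * z) ≤ Real.exp (2 * z) := by nlinarith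
  have h5 := mul_le_mul_of_nonneg_right h4 (Real.exp_pos (s * z)).le
  rw [add_mul, mul_assoc, ← Real.exp_add, ← Real.exp_add] at h5
  rw [show (s + 2) * z = 2 * z + s * z by ring]
  simpa using h5

/-- The case `K = 3`: to first order `8 / 9 * s + 9 / 2 ≤ s + 4`, that is `9 / 2 ≤ s`, which `s = τ
+ 2` satisfies once `τ ≥ 3`. -/
theorem damped_exp_le_three {s z : ℝ} (hs : 5 ≤ s) (hz : 0 ≤ z) :
    1 / 9 + (8 / 9 + 9 / 2 * z) * Real.exp (s * z) ≤ Real.exp ((s + 4) * z) := by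
  have h1 := Real.quadratic_le_exp_of_nonneg (show 0 ≤ 4 * z by linarith)
  have h2 := exp_neg_le_quadratic (show 0 ≤ 5 * z by linarith)
  have h3 : Real.exp (-(s * z)) ≤ Real.exp (-(5 * z)) :=
    Real.exp_le_exp.2 (by nlinarith)
  have h4 : 1 / 9 * Real.exp (-(s * z)) + (8 / 9 + 9 / 2 * z) ≤ Real.exp (4 * z) := by nlinarith
  have h5 := mul_le_mul_of_nonneg_right h4 (Real.exp_pos (s * z)).le
  rw [add_mul, mul_assoc, ← Real.exp_add, ← Real.exp_add] at h5
  rw [show (s + 4) * z = 4 * z + s * z by ring]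
  simpa using h5

theorem damped_mass_le {K d τ : ℕ} (hK : 2 ≤ K) (hτ : τ ≤ d) {z : ℝ} (hz : 0 ≤ z) :
    1 - (1 - damping K d τ) + (1 - damping K d τ + K * (3 / 2 * z)) *
      Real.exp (τ * (Real.exp (2 / (d + 2)) * z)) ≤ Real.exp (z * (2 * K + τ)) := by
  unfold damping
  split_ifs with h
  · have h1 : τ * (Real.exp (2 / (d + 2)) * z) ≤ (τ + K / 2) * z := by nlinarith
    have h2 := Real.add_one_le_exp (K * (3 / 2 * z))
    calc _ = (K * (3 / 2 * z) + 1) * Real.exp (τ * (Real.exp (2 / (d + 2)) * z)) := by ring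
      _ ≤ Real.exp (K * (3 / 2 * z)) * Real.exp ((τ + K / 2) * z) := by gcongr
      _ = _ := by rw [← Real.exp_add]; ring_nf
  · have h1 : Real.exp (τ * (Real.exp (2 / (d + 2)) * z)) ≤ Real.exp (((τ : ℝ) + 2) * z) := by
      refine Real.exp_le_exp.2 ?_
      have := mul_le_mul_of_nonneg_right (exp_two_div_mul_le hτ) hz
      linarith
    rcases small_of_crude_bound_fails hK hτ h with ⟨rfl, h2⟩ | ⟨rfl, h2⟩
    · have h3 : (2 : ℝ) ≤ τ := by exact_mod_cast h2
      have h4 := damped_exp_le_two (s := τ + 2) (by linarith) hz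
      have h5 := mul_le_mul_of_nonneg_left h1 (show 0 ≤ 3 / 4 + 3 * z by positivity)
      push_cast
      rw [show z * (2 * 2 + (τ : ℝ)) = (τ + 2 + 2) * z by ring]
      calc _ = 1 / 4 + (3 / 4 + 3 * z) *
            Real.exp (τ * (Real.exp (2 / (d + 2)) * z)) := by ring
        _ ≤ _ := by linarith
    · have h3 : (3 : ℝ) ≤ τ := by exact_mod_cast h2
      have h4 := damped_exp_le_three (s := τ + 2) (by linarith) hz
      have h5 := mul_le_mul_of_nonneg_left h1 (show 0 ≤ 8 / 9 + 9 / 2 * z by positivity)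
      push_cast
      rw [show z * (2 * 3 + (τ : ℝ)) = (τ + 2 + 4) * z by ring]
      calc _ = 1 / 9 + (8 / 9 + 9 / 2 * z) *
            Real.exp (τ * (Real.exp (2 / (d + 2)) * z)) := by ring
        _ ≤ _ := by linarith

variable {α : Type*} [Fintype α] [Nonempty α]

/-- An action of maximal weight. -/
noncomputable def mode (q : α → ℝ) : α := (Finite.exists_max q).choose

theorem le_mode (q : α → ℝ) (i : α) : q i ≤ q (mode q) := (Finite.exists_max q).choose_spec i

theorem inv_card_le_mode {q : α → ℝ} (hq : ∑ i, q i = 1) :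
    (Fintype.card α : ℝ)⁻¹ ≤ q (mode q) := by
  have hc : (0 : ℝ) < Fintype.card α := by exact_mod_cast Fintype.card_pos
  rw [inv_le_iff_one_le_mul₀ hc, ← hq]
  calc ∑ i, q i ≤ ∑ _i : α, q (mode q) := Finset.sum_le_sum fun i _ => le_mode q i
    _ = _ := by simp [mul_comm]

variable [DecidableEq α]

/-- The factor by which the drift of a round is reduced, depending on the action. -/
noncomputable def driftFactor (ν : ℝ) (q : α → ℝ) (i : α) : ℝ :=
  1 - if mode q = i then ν / q i else 0

/-- Dividing `ν` by the probability of the mode makes the mean reduction independent of the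
distribution, so the mass of a round stays deterministic. The mode has probability at least `1 / K`,
which keeps the reduction admissible. -/
theorem sum_mul_driftFactor {q : α → ℝ} (hq : ∑ i, q i = 1) (ν : ℝ) :
    ∑ i, q i * driftFactor ν q i = 1 - ν := by
  have hc : (0 : ℝ) < Fintype.card α := by exact_mod_cast Fintype.card_pos
  have hm : 0 < q (mode q) := (inv_pos.2 hc).trans_le (inv_card_le_mode hq)
  simp only [driftFactor, mul_sub, mul_one, mul_ite, mul_zero]
  rw [Finset.sum_sub_distrib, hq, Finset.sum_ite_eq Finset.univ (mode q)]
  simp [mul_div_cancel₀ _ hm.ne']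

theorem one_sub_driftFactor_le {q : α → ℝ} (hq0 : ∀ i, 0 ≤ q i) (hq : ∑ i, q i = 1) {ν : ℝ}
    (hα : 2 ≤ Fintype.card α) (hν : ν ≤ 1 / (Fintype.card α : ℝ) ^ 2) (i : α) :
    1 - driftFactor ν q i ≤ q i ∧ 1 - driftFactor ν q i ≤ 1 / 2 := by
  have hα' : (2 : ℝ) ≤ Fintype.card α := by exact_mod_cast hα
  simp only [driftFactor, sub_sub_cancel]
  split_ifs with h
  · subst h
    have h1 := inv_card_le_mode hq
    set c := (Fintype.card α : ℝ)⁻¹ with hc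
    have hc0 : 0 < c := inv_pos.2 (by linarith)
    have hc2 : c ≤ 1 / 2 := by rw [hc, inv_le_comm₀ (by linarith) (by norm_num)]; linarith
    have hν' : ν ≤ c ^ 2 := by rw [hc, inv_pow, ← one_div]; exact hν
    have hm : 0 < q (mode q) := hc0.trans_le h1
    constructor <;> rw [div_le_iff₀ hm] <;> nlinarith
  · exact ⟨hq0 i, by norm_num⟩

theorem driftFactor_le_one {q : α → ℝ} (hq0 : ∀ i, 0 ≤ q i) {ν : ℝ} (hν : 0 ≤ ν) (i : α) :
    driftFactor ν q i ≤ 1 := by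
  unfold driftFactor
  split_ifs
  · have := div_nonneg hν (hq0 i)
    linarith
  · simp

end Damping

/-! ### Step sizes and their sums. -/

section Rounds

theorem sum_div_sqrt_le (b : ℕ → ℝ) (hb : ∀ t, 1 ≤ t → 0 < b t) (T : ℕ) :
    ∑ t ∈ Finset.Icc 1 T, b t / √(∑ s ∈ Finset.Icc 1 t, b s) ≤
      2 * √(∑ s ∈ Finset.Icc 1 T, b s) := by
  induction T with
  | zero => simp
  | succ n ih =>
    rw [Finset.sum_Icc_succ_top (by omega), Finset.sum_Icc_succ_top (f := b) (by omega)]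
    set B := ∑ s ∈ Finset.Icc 1 n, b s with hB
    have hB0 : 0 ≤ B := Finset.sum_nonneg fun s hs => (hb s (Finset.mem_Icc.1 hs).1).le
    have hbn := hb (n + 1) (by omega)
    have hpos : 0 < √(B + b (n + 1)) := Real.sqrt_pos.2 (by linarith)
    have hle : √B ≤ √(B + b (n + 1)) := Real.sqrt_le_sqrt (by linarith)
    have h1 : b (n + 1) / √(B + b (n + 1)) ≤ 2 * √(B + b (n + 1)) - 2 * √B := by
      rw [div_le_iff₀ hpos]
      nlinarith [Real.sq_sqrt hB0, Real.sq_sqrt (show 0 ≤ B + b (n + 1) by linarith),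
        sq_nonneg (√(B + b (n + 1)) - √B)]
    linarith

/-- The denominator `2 t K + τ_1 + … + τ_t` of the step size. -/
noncomputable def stepDenom (K : ℕ) (d : ℕ → ℕ) (t : ℕ) : ℝ :=
  2 * t * K + ∑ s ∈ Finset.Icc 1 t, (numMissing d s : ℝ)

theorem stepDenom_eq_sum (K : ℕ) (d : ℕ → ℕ) (t : ℕ) :
    stepDenom K d t = ∑ s ∈ Finset.Icc 1 t, (2 * (K : ℝ) + numMissing d s) := by
  rw [Finset.sum_add_distrib]
  simp [stepDenom]
  ring

variable {K : ℕ} (hK : 2 ≤ K) (d : ℕ → ℕ)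
include hK

theorem stepDenom_pos {t : ℕ} (ht : 1 ≤ t) : 0 < stepDenom K d t := by
  have h1 : (2 : ℝ) ≤ K := by exact_mod_cast hK
  have h2 : (1 : ℝ) ≤ t := by exact_mod_cast ht
  have h3 : (0 : ℝ) ≤ ∑ s ∈ Finset.Icc 1 t, (numMissing d s : ℝ) := by positivity
  unfold stepDenom
  nlinarith

theorem log_card_pos : 0 < Real.log K := Real.log_pos (by exact_mod_cast hK)

theorem stepSize_eq (t : ℕ) :
    stepSize K d t = √(3 * Real.log K) / (2 * √(stepDenom K d t)) := by
  unfold stepSize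
  rw [← stepDenom, Real.sqrt_div (by have := log_card_pos hK; positivity)]
  field_simp

theorem stepSize_pos {t : ℕ} (ht : 1 ≤ t) : 0 < stepSize K d t := by
  have h1 := stepDenom_pos hK d ht
  have h2 := log_card_pos hK
  rw [stepSize_eq hK]
  positivity

theorem stepSize_anti {s t : ℕ} (hs : 1 ≤ s) (hst : s ≤ t) : stepSize K d t ≤ stepSize K d s := by
  have h1 := stepDenom_pos hK d hs
  have h2 : stepDenom K d s ≤ stepDenom K d t := by
    rw [stepDenom_eq_sum, stepDenom_eq_sum]
    exact Finset.sum_le_sum_of_subset_of_nonneg (Finset.Icc_subset_Icc_right hst)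
      fun _ _ _ => by positivity
  rw [stepSize_eq hK, stepSize_eq hK]
  gcongr

theorem sum_stepSize_mul_le (T : ℕ) :
    ∑ t ∈ Finset.Icc 1 T, stepSize K d t * (2 * K + numMissing d t) ≤
      √(3 * Real.log K) * √(stepDenom K d T) := by
  have hK0 : (0 : ℝ) < K := by exact_mod_cast (by omega : 0 < K)
  have h := sum_div_sqrt_le (fun s => 2 * (K : ℝ) + numMissing d s)
    (fun t _ => by positivity) T
  simp only [← stepDenom_eq_sum] at h
  have h2 := mul_le_mul_of_nonneg_left h
    (show 0 ≤ √(3 * Real.log K) / 2 from by positivity)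
  rw [Finset.mul_sum] at h2
  calc _ = ∑ t ∈ Finset.Icc 1 T, √(3 * Real.log K) / 2 *
        ((2 * K + numMissing d t) / √(stepDenom K d t)) := by
        refine Finset.sum_congr rfl fun t _ => ?_
        rw [stepSize_eq hK]
        field_simp
    _ ≤ _ := h2
    _ = _ := by ring

end Rounds

/-! ### Counting missing rounds. -/

section Delays

variable (d : ℕ → ℕ)

theorem mem_missing {r t : ℕ} : r ∈ missing d t ↔ (1 ≤ r ∧ r < t) ∧ t ≤ r + d r := by
  simp [missing]

theorem numMissing_le_maxDelay {T t : ℕ} (ht : t ≤ T) : numMissing d t ≤ maxDelay T d := by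
  have : missing d t ⊆ Finset.Ico (t - maxDelay T d) t := by
    intro r hr
    rw [mem_missing] at hr
    have : d r ≤ maxDelay T d := Finset.le_sup (f := d) (Finset.mem_Icc.2 ⟨hr.1.1, by omega⟩)
    rw [Finset.mem_Ico]
    omega
  refine (Finset.card_le_card this).trans ?_
  rw [Nat.card_Ico]
  omega

/-- Double counting: round `r` is missing only at times in `(r, r + d r]`. -/
theorem sum_numMissing_le_cumDelay (T : ℕ) :
    ∑ t ∈ Finset.Icc 1 T, numMissing d t ≤ cumDelay T d := by
  have h : ∀ t ∈ Finset.Icc 1 T, numMissing d t =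
      ∑ r ∈ Finset.Icc 1 T, if r ∈ missing d t then 1 else 0 := by
    intro t ht
    rw [Finset.sum_boole, Nat.cast_id, numMissing]
    congr 1
    ext r
    rw [Finset.mem_filter, Finset.mem_Icc]
    refine ⟨fun hr => ⟨?_, hr⟩, fun hr => hr.2⟩
    have h1 := (mem_missing d).1 hr
    have h2 := Finset.mem_Icc.1 ht
    omega
  rw [Finset.sum_congr rfl h, Finset.sum_comm]
  refine Finset.sum_le_sum fun r _ => ?_
  rw [Finset.sum_boole, Nat.cast_id]
  refine (Finset.card_le_card (t := Finset.Ioc r (r + d r)) ?_).trans (by simp)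
  intro t ht
  have h1 := (mem_missing d).1 (Finset.mem_filter.1 ht).2
  rw [Finset.mem_Ioc]
  omega

theorem stepDenom_le (K T : ℕ) : stepDenom K d T ≤ 2 * T * K + cumDelay T d := by
  unfold stepDenom
  have := sum_numMissing_le_cumDelay d T
  have h2 : (∑ s ∈ Finset.Icc 1 T, (numMissing d s : ℝ)) ≤ cumDelay T d := by exact_mod_cast this
  linarith

end Delays

/-! ### The sampling distributions. -/

section Prob

variable {K : ℕ} (η γ : ℕ → ℝ) (d : ℕ → ℕ) (ℓ : ℕ → Fin K → ℝ)

theorem prob_nonneg (a : ℕ → Fin K) (t : ℕ) (i : Fin K) : 0 ≤ prob η γ d ℓ a t i := by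
  rw [prob_eq]
  positivity

theorem sum_prob (hK : 0 < K) (a : ℕ → Fin K) (t : ℕ) : ∑ i, prob η γ d ℓ a t i = 1 := by
  have : Nonempty (Fin K) := ⟨⟨0, hK⟩⟩
  simp only [prob_eq η γ d ℓ a t]
  rw [← Finset.sum_div]
  exact div_self (Finset.sum_pos (fun _ _ => Real.exp_pos _) Finset.univ_nonempty).ne'

/-- `p_t` depends only on the actions whose feedback has arrived before round `t`. -/
theorem prob_congr {a b : ℕ → Fin K} (t : ℕ) (h : ∀ r, 1 ≤ r → r + d r < t → a r = b r) :
    prob η γ d ℓ a t = prob η γ d ℓ b t := by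
  induction t using Nat.strong_induction_on with
  | _ t ih =>
    funext i
    have hs : ∀ s : {s : ℕ // s ∈ Finset.Ico 1 t \ missing d t},
        1 ≤ s.1 ∧ s.1 < t ∧ s.1 + d s.1 < t := by
      rintro ⟨s, hs⟩
      rw [Finset.mem_sdiff, Finset.mem_Ico, mem_missing] at hs
      dsimp only
      omega
    have key : ∀ j : Fin K, ∀ s : {s : ℕ // s ∈ Finset.Ico 1 t \ missing d t},
        ℓ s.1 j * (if a s.1 = j then 1 else 0) / (prob η γ d ℓ a s.1 j + γ s.1) =
        ℓ s.1 j * (if b s.1 = j then 1 else 0) / (prob η γ d ℓ b s.1 j + γ s.1) := by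
      intro j s
      obtain ⟨h1, h2, h3⟩ := hs s
      rw [h s.1 h1 h3, ih s.1 h2 fun r hr hrs => h r hr (by omega)]
    rw [prob, prob]
    simp only [key]

theorem lossEst_eq (a : ℕ → Fin K) (t : ℕ) (i : Fin K) :
    lossEst η γ d ℓ a t i =
      if a t = i then ℓ t (a t) / (prob η γ d ℓ a t (a t) + γ t) else 0 := by
  unfold lossEst
  split_ifs with h <;> simp [h]

end Prob


/-! ### Finite trajectories of actions. -/

section Trajectories

variable {K T : ℕ}

/-- Extension of a sequence of actions of the rounds `1, …, T` to all rounds. -/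
def extend (i₀ : Fin K) (a : Finset.Icc 1 T → Fin K) (t : ℕ) : Fin K :=
  if h : t ∈ Finset.Icc 1 T then a ⟨t, h⟩ else i₀

@[simp]
theorem extend_coe (i₀ : Fin K) (a : Finset.Icc 1 T → Fin K) (t : Finset.Icc 1 T) :
    extend i₀ a t = a t := by
  simp only [extend, t.2, dif_pos]

/-- The missing rounds as a set of rounds in `1, …, T`. -/
def missingRounds (d : ℕ → ℕ) (t : Finset.Icc 1 T) : Finset (Finset.Icc 1 T) :=
  Finset.univ.filter fun r => r.1 ∈ missing d t.1

theorem mem_missingRounds {d : ℕ → ℕ} {r t : Finset.Icc 1 T} :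
    r ∈ missingRounds d t ↔ r.1 < t.1 ∧ t.1 ≤ r.1 + d r.1 := by
  have := (Finset.mem_Icc.1 r.2).1
  simp only [missingRounds, Finset.mem_filter, Finset.mem_univ, true_and, mem_missing, this]

theorem sum_missingRounds {M : Type*} [AddCommMonoid M] (d : ℕ → ℕ) (t : Finset.Icc 1 T)
    (F : ℕ → M) : ∑ r ∈ missingRounds d t, F r.1 = ∑ r ∈ missing d t.1, F r := by
  rw [missingRounds, Finset.sum_filter,
    Finset.sum_coe_sort (Finset.Icc 1 T) (fun r => if r ∈ missing d t.1 then F r else 0),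
    ← Finset.sum_filter]
  congr 1
  ext r
  rw [Finset.mem_filter, Finset.mem_Icc]
  refine ⟨fun hr => hr.2, fun hr => ⟨?_, hr⟩⟩
  have h1 := (mem_missing d).1 hr
  have h2 := Finset.mem_Icc.1 t.2
  omega

theorem card_missingRounds (d : ℕ → ℕ) (t : Finset.Icc 1 T) :
    (missingRounds d t).card = numMissing d t.1 := by
  have := sum_missingRounds d t (fun _ => 1)
  simpa [numMissing] using this

theorem card_filter_missingRounds_le (d : ℕ → ℕ) (t : Finset.Icc 1 T) :
    (Finset.univ.filter fun s => t ∈ missingRounds d s).card ≤ d t.1 := by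
  calc _ ≤ (Finset.Ioc t.1 (t.1 + d t.1)).card := by
        refine Finset.card_le_card_of_injOn (fun s => s.1) ?_ Subtype.val_injective.injOn
        intro s hs
        have hs' := mem_missingRounds.1 (Finset.mem_filter.1 hs).2
        simpa using hs'
    _ = d t.1 := by simp

end Trajectories

/-! ### Exponential moments of the excess and of the estimates. -/

section Moments

variable {K T : ℕ} (hK : 2 ≤ K) (d : ℕ → ℕ) (ℓ : ℕ → Fin K → ℝ)
  (hℓ : ∀ t ∈ Finset.Icc 1 T, ∀ i, ℓ t i ∈ Set.Icc (0 : ℝ) 1)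

/-- The regret of round `t` against the growth of the potential. -/
noncomputable def roundExcess (η : ℕ → ℝ) (d : ℕ → ℕ) (ℓ : ℕ → Fin K → ℝ) (a : ℕ → Fin K)
    (t : ℕ) : ℝ :=
  ℓ t (a t) - (potential (η t) (cumEst η η d ℓ a (t + 1)) - potential (η t) (cumEst η η d ℓ a t))

theorem cumEst_succ (η γ : ℕ → ℝ) (a : ℕ → Fin K) {t : ℕ} (ht : 1 ≤ t) (i : Fin K) :
    cumEst η γ d ℓ a (t + 1) i = cumEst η γ d ℓ a t i + lossEst η γ d ℓ a t i := by
  unfold cumEst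
  rw [Finset.sum_Ico_succ_top ht]

theorem extend_congr (i₀ : Fin K) {t : Finset.Icc 1 T} {a b : Finset.Icc 1 T → Fin K}
    (h : ∀ r < t, r ∉ missingRounds d t → a r = b r) :
    ∀ r, 1 ≤ r → r + d r < t.1 → extend i₀ a r = extend i₀ b r := by
  intro r hr hrt
  have ht := Finset.mem_Icc.1 t.2
  have hmem : r ∈ Finset.Icc 1 T := Finset.mem_Icc.2 ⟨hr, by omega⟩
  have := h ⟨r, hmem⟩ (Subtype.mk_lt_mk.2 (by omega)) (by
    rw [mem_missingRounds]
    simp only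
    omega)
  simp only [extend, hmem, dif_pos, this]

include hℓ

theorem lossEst_nonneg {η : ℕ → ℝ} (hη : ∀ t, 1 ≤ t → 0 < η t) (a : ℕ → Fin K) {t : ℕ}
    (ht : t ∈ Finset.Icc 1 T) (i : Fin K) : 0 ≤ lossEst η η d ℓ a t i := by
  have := hη t (Finset.mem_Icc.1 ht).1
  have := prob_nonneg η η d ℓ a t (a t)
  have := (hℓ t ht (a t)).1
  rw [lossEst_eq]
  split_ifs <;> positivity

include hK

theorem roundExcess_le_one {η : ℕ → ℝ} (hη : ∀ t, 1 ≤ t → 0 < η t) (a : ℕ → Fin K) {t : ℕ}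
    (ht : t ∈ Finset.Icc 1 T) : roundExcess η d ℓ a t ≤ 1 := by
  have : Nonempty (Fin K) := ⟨⟨0, by omega⟩⟩
  have ht1 := (Finset.mem_Icc.1 ht).1
  have h1 := (hℓ t ht (a t)).2
  have h2 : potential (η t) (cumEst η η d ℓ a t) ≤ potential (η t) (cumEst η η d ℓ a (t + 1)) :=
    potential_mono (hη t ht1) fun i => by
      rw [cumEst_succ d ℓ η η a ht1]
      linarith [lossEst_nonneg d ℓ hℓ hη a ht i]
  unfold roundExcess
  linarith

theorem roundExcess_le [Nonempty (Fin K)] {η : ℕ → ℝ} (hη : ∀ t, 1 ≤ t → 0 < η t) (a : ℕ → Fin K) {t : ℕ}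
    (ht : t ∈ Finset.Icc 1 T) {ν : ℝ} (hν : ν ≤ 1 / (K : ℝ) ^ 2) :
    roundExcess η d ℓ a t ≤
      driftFactor ν (prob η η d ℓ a t) (a t) * (η t * missingEst η η d ℓ a t (a t)) +
        3 / 2 * (η t * (ℓ t (a t) / (prob η η d ℓ a t (a t) + η t))) := by
  have ht1 := (Finset.mem_Icc.1 ht).1
  have hmiss : ∀ i, 0 ≤ missingEst η η d ℓ a t i := fun i => Finset.sum_nonneg fun r hr => by
    have hr' := (mem_missing d).1 hr
    refine lossEst_nonneg d ℓ hℓ hη a (Finset.mem_Icc.2 ⟨hr'.1.1, ?_⟩) i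
    have := (Finset.mem_Icc.1 ht).2
    omega
  obtain ⟨h1, h2⟩ := one_sub_driftFactor_le (prob_nonneg η η d ℓ a t)
    (sum_prob η η d ℓ (by omega) a t) (ν := ν) (by simpa using hK) (by simpa using hν) (a t)
  have h := loss_sub_potential_le (hη t ht1) (cumEst η η d ℓ a t) (missingEst η η d ℓ a t)
    hmiss (a t) (hℓ t ht (a t)).1 (hℓ t ht (a t)).2 (prob_eq η η d ℓ a t (a t)) h1 h2 rfl
  rw [sub_sub_cancel] at h
  have hL : cumEst η η d ℓ a (t + 1) = fun i => cumEst η η d ℓ a t i +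
      if a t = i then ℓ t (a t) / (prob η η d ℓ a t (a t) + η t) else 0 := by
    funext i
    rw [cumEst_succ d ℓ η η a ht1, lossEst_eq]
  unfold roundExcess
  rwa [hL]

/-- Exponential moment of the total excess. -/
theorem sum_prod_exp_roundExcess_le (i₀ : Fin K) :
    ∑ a : Finset.Icc 1 T → Fin K, ∏ t : Finset.Icc 1 T,
      prob (stepSize K d) (stepSize K d) d ℓ (extend i₀ a) t (a t) *
        Real.exp (2 / (maxDelay T d + 2) * roundExcess (stepSize K d) d ℓ (extend i₀ a) t) ≤
    Real.exp (2 / (maxDelay T d + 2) *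
      ∑ t ∈ Finset.Icc 1 T, stepSize K d t * (2 * K + numMissing d t)) := by
  have : Nonempty (Fin K) := ⟨i₀⟩
  set η := stepSize K d with hηdef
  have hη : ∀ t, 1 ≤ t → 0 < η t := fun t ht => stepSize_pos hK d ht
  have hη' : ∀ t : Finset.Icc 1 T, 0 < η t := fun t => hη t (Finset.mem_Icc.1 t.2).1
  set D := maxDelay T d with hD
  -- A round collects at most `D * (lam * η t)` from later rounds and has `3 / 2 * (lam * η t)` of
  -- its own; `lam * (D + 2) = 2` keeps the total below the `2 * η t` allowed by `mul_exp_le_add`.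
  set lam : ℝ := 2 / (D + 2) with hlam
  have hlam0 : 0 < lam := by positivity
  let ν : Finset.Icc 1 T → ℝ := fun t => damping K D (numMissing d t)
  have hν0 : ∀ t, 0 ≤ ν t := fun t => damping_nonneg _ _ _
  have hνK : ∀ t, ν t ≤ 1 / (K : ℝ) ^ 2 := fun t => damping_le _ _ _
  let p : Finset.Icc 1 T → (Finset.Icc 1 T → Fin K) → Fin K → ℝ := fun t a =>
    prob η η d ℓ (extend i₀ a) t
  have hp0 : ∀ t a i, 0 ≤ p t a i := fun t a i => prob_nonneg _ _ _ _ _ _ _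
  have hp1 : ∀ t a, ∑ i, p t a i = 1 := fun t a => sum_prob _ _ _ _ (by omega) _ _
  have hpdep : ∀ t a b, (∀ r < t, r ∉ missingRounds d t → a r = b r) → p t a = p t b :=
    fun t a b h => prob_congr _ _ _ _ _ (extend_congr d i₀ h)
  let σ : Finset.Icc 1 T → (Finset.Icc 1 T → Fin K) → Fin K → ℝ := fun t a =>
    driftFactor (ν t) (p t a)
  let h : Finset.Icc 1 T → (Finset.Icc 1 T → Fin K) → ℝ := fun t a =>
    ℓ t (a t) / (p t a (a t) + η t)
  have hpη : ∀ t a i, 0 < p t a i + η t := fun t a i =>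
    add_pos_of_nonneg_of_pos (hp0 t a i) (hη' t)
  have hh0 : ∀ t a, 0 ≤ h t a := fun t a =>
    div_nonneg (hℓ t t.2 (a t)).1 (hpη t a (a t)).le
  have hhalf : ∀ t a i, 1 / 2 ≤ σ t a i := fun t a i => by
    have := (one_sub_driftFactor_le (hp0 t a) (hp1 t a) (ν := ν t) (by simpa using hK)
      (by simpa using hνK t) i).2
    simp only [σ]
    linarith
  have key := sum_prod_exp_le (O := missingRounds d) (p := p) (σ := σ)
    (β := fun t => 1 - ν t) (w := fun t => lam * η t) (u := fun t => 3 / 2 * (lam * η t))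
    (E := Real.exp lam)
    (fun t r hr => (mem_missingRounds.1 hr).1)
    (fun r s t hr hrs hst => mem_missingRounds.2
      ⟨hrs, (show s.1 ≤ t.1 from hst).trans (mem_missingRounds.1 hr).2⟩)
    hp0 hp1 hpdep (fun t a b hab => by simp only [σ, hpdep t a b hab])
    (fun t a i => by linarith [hhalf t a i])
    (fun t a i => driftFactor_le_one (hp0 t a) (hν0 t) i)
    (fun t a => sum_mul_driftFactor (hp1 t a) (ν t))
    (fun t => (mul_pos hlam0 (hη' t)).le)
    (fun t => by have := mul_pos hlam0 (hη' t); positivity) (Real.exp_pos _).le h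
    (fun t a => lam * roundExcess η d ℓ (extend i₀ a) t) ?_
  · refine key.trans ?_
    rw [Finset.mul_sum, ← Finset.sum_coe_sort (Finset.Icc 1 T), Real.exp_sum]
    refine Finset.prod_le_prod (fun t _ => ?_) fun t _ => ?_
    · have h1 : ν t ≤ 1 := by
        refine (hνK t).trans (div_le_one_of_le₀ (one_le_pow₀ ?_) (by positivity))
        exact_mod_cast (by omega : 1 ≤ K)
      have h2 := mul_pos hlam0 (hη' t)
      have h3 := hν0 t
      have h4 : 0 ≤ 1 - ν t := by linarith
      have h5 : 0 ≤ 1 - (1 - ν t) := by linarith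
      positivity
    · have h1 := damped_mass_le hK (numMissing_le_maxDelay d (Finset.mem_Icc.1 t.2).2)
        (mul_pos hlam0 (hη' t)).le
      rw [card_missingRounds, Fintype.card_fin]
      rw [mul_assoc] at h1
      exact h1
  · intro t a C hC0 hC
    have ht1 := (Finset.mem_Icc.1 t.2).1
    have hCle : C ≤ D * (lam * η t) := by
      refine hC.trans ?_
      calc _ = ∑ s ∈ Finset.univ.filter (fun s => t ∈ missingRounds d s), lam * η s := by
            rw [Finset.sum_filter]
            exact Finset.sum_congr rfl fun s _ => by congr
        _ ≤ ∑ s ∈ Finset.univ.filter (fun s => t ∈ missingRounds d s), lam * η t := by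
            refine Finset.sum_le_sum fun s hs => mul_le_mul_of_nonneg_left ?_ hlam0.le
            exact stepSize_anti hK d ht1
              (mem_missingRounds.1 (Finset.mem_filter.1 hs).2).1.le
        _ ≤ _ := by
            rw [Finset.sum_const, nsmul_eq_mul]
            refine mul_le_mul_of_nonneg_right ?_ (mul_pos hlam0 (hη' t)).le
            exact_mod_cast (card_filter_missingRounds_le d t).trans (Finset.le_sup (f := d) t.2)
    have hX : ∑ r ∈ missingRounds d t, (if a t = a r then lam * η t * h r a else 0) =
        lam * (η t * missingEst η η d ℓ (extend i₀ a) t (a t)) := by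
      rw [missingEst, ← sum_missingRounds, Finset.mul_sum, Finset.mul_sum]
      refine Finset.sum_congr rfl fun r _ => ?_
      rw [lossEst_eq, extend_coe]
      by_cases har : a t = a r
      · rw [if_pos har, if_pos har.symm]
        simp only [h, p]
        ring
      · rw [if_neg har, if_neg (Ne.symm har)]
        ring
    refine mul_exp_le_expansion (γ := η t) (hp0 _ _ _) (hη' t) (by linarith [hhalf t a (a t)])
      (driftFactor_le_one (hp0 t a) (hν0 t) (a t))
      (by have := mul_pos hlam0 (hη' t); positivity) hC0 ?_ ?_ ?_ hlam0.le
      (roundExcess_le_one hK d ℓ hℓ hη _ t.2) ?_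
    · have h1 : lam * (D + 2) = 2 := by rw [hlam]; field_simp
      have h2 := mul_pos hlam0 (hη' t)
      nlinarith [hη' t]
    · exact div_le_div_of_nonneg_right (hℓ t t.2 (a t)).2 (hpη t a (a t)).le
    · exact Finset.sum_nonneg fun r _ => by
        split_ifs
        · exact mul_nonneg (mul_pos hlam0 (hη' t)).le (hh0 r a)
        · rfl
    · have h1 := roundExcess_le hK d ℓ hℓ hη (extend i₀ a) t.2 (hνK t)
      rw [extend_coe] at h1
      rw [hX]
      have h2 := mul_le_mul_of_nonneg_left h1 hlam0.le
      simp only [σ, h, p]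
      linarith

/-- Exponential moment of the estimates of a single action. -/
theorem sum_prod_exp_lossEst_le (i₀ i : Fin K) {η : ℕ → ℝ} (hη : ∀ t, 1 ≤ t → 0 < η t) {c : ℝ}
    (hc0 : 0 ≤ c) (hc : ∀ t ∈ Finset.Icc 1 T, c ≤ 2 * η t) :
    ∑ a : Finset.Icc 1 T → Fin K, ∏ t : Finset.Icc 1 T,
      prob η η d ℓ (extend i₀ a) t (a t) *
        Real.exp (c * (lossEst η η d ℓ (extend i₀ a) t i - ℓ t i)) ≤ 1 := by
  have : Nonempty (Fin K) := ⟨i₀⟩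
  let p : Finset.Icc 1 T → (Finset.Icc 1 T → Fin K) → Fin K → ℝ := fun t a =>
    prob η η d ℓ (extend i₀ a) t
  have hp0 : ∀ t a i, 0 ≤ p t a i := fun t a i => prob_nonneg _ _ _ _ _ _ _
  have hp1 : ∀ t a, ∑ i, p t a i = 1 := fun t a => sum_prob _ _ _ _ (by omega) _ _
  have hpdep : ∀ t s, t ≤ s → ∀ a x, p t (Function.update a s x) = p t a :=
    fun t s hts a x => prob_congr _ _ _ _ _ (extend_congr d i₀ fun r hr _ =>
      Function.update_of_ne (hr.trans_le hts).ne _ _)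
  let g : Finset.Icc 1 T → (Finset.Icc 1 T → Fin K) → ℝ := fun t a =>
    p t a (a t) * Real.exp (c * ((if a t = i then ℓ t i / (p t a i + η t) else 0) - ℓ t i))
  have hg : ∀ (t : Finset.Icc 1 T) (a : Finset.Icc 1 T → Fin K), prob η η d ℓ (extend i₀ a) t (a t) *
      Real.exp (c * (lossEst η η d ℓ (extend i₀ a) t i - ℓ t i)) = g t a := by
    intro t a
    simp only [g, p, lossEst_eq, extend_coe]
    split_ifs with hai
    · rw [hai]
    · rfl
  simp only [hg]
  have key := sum_prod_adapted_le (fun t : Finset.Icc 1 T => t) g (fun _ => 1)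
    (fun t a => mul_nonneg (hp0 _ _ _) (Real.exp_pos _).le) ?_ ?_
  · simpa using key
  · intro t s hts hle a x
    simp only [g, hpdep t s hle, Function.update_of_ne hts]
  · intro t a
    simp only [g, hpdep t t le_rfl, Function.update_self]
    have hη' := hη t (Finset.mem_Icc.1 t.2).1
    obtain ⟨hl0, hl1⟩ := hℓ t t.2 i
    set l := ℓ t i with hl
    set q := p t a with hq
    have h1 := mul_exp_le_add (h := 1 / (q i + η t)) (hp0 t a i) hη' (mul_nonneg hc0 hl0)
      (by have := hc t t.2; nlinarith) le_rfl
    have h2 : ∀ x, q x * Real.exp (c * ((if x = i then l / (q i + η t) else 0) - l)) ≤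
        (q x + if x = i then c * l else 0) * Real.exp (-(c * l)) := by
      intro x
      rw [mul_sub, sub_eq_add_neg, Real.exp_add, ← mul_assoc]
      refine mul_le_mul_of_nonneg_right ?_ (Real.exp_pos _).le
      split_ifs with hx
      · subst hx
        rwa [show c * (l / (q x + η t)) = c * l * (1 / (q x + η t)) by ring]
      · simp
    refine (Finset.sum_le_sum fun x _ => h2 x).trans ?_
    rw [← Finset.sum_mul, Finset.sum_add_distrib, hp1, Finset.sum_ite_eq' Finset.univ i]
    simp only [Finset.mem_univ, if_true]
    calc (1 + c * l) * Real.exp (-(c * l)) ≤ Real.exp (c * l) * Real.exp (-(c * l)) := by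
          refine mul_le_mul_of_nonneg_right ?_ (Real.exp_pos _).le
          linarith [Real.add_one_le_exp (c * l)]
      _ = 1 := by rw [← Real.exp_add]; simp

end Moments


/-! ### From weights of trajectories to probabilities. -/

open MeasureTheory in
theorem measure_actions_eq {K T : ℕ} {η γ : ℕ → ℝ} {d : ℕ → ℕ} {ℓ : ℕ → Fin K → ℝ}
    {Ω : Type*} [MeasurableSpace Ω] {μ : Measure Ω} [IsProbabilityMeasure μ] {A : ℕ → Ω → Fin K}
    (hA : IsDAdaExp3 T η γ d ℓ μ A) (a : ℕ → Fin K) {n : ℕ} (hn : n ≤ T) :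
    μ {ω | ∀ s ∈ Finset.Icc 1 n, A s ω = a s} =
      ENNReal.ofReal (∏ s ∈ Finset.Icc 1 n, prob η γ d ℓ a s (a s)) := by
  induction n with
  | zero => simp
  | succ n ih =>
    rw [hA.law (n + 1) (Finset.mem_Icc.2 ⟨by omega, hn⟩) a,
      show Finset.Ico 1 (n + 1) = Finset.Icc 1 n from rfl, ih (by omega),
      Finset.prod_Icc_succ_top (by omega), ENNReal.ofReal_mul]
    exact Finset.prod_nonneg fun s _ => prob_nonneg _ _ _ _ _ _ _

open MeasureTheory in
/-- An event which is determined by the actions has probability at least `1 - δ` if the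
trajectories outside have total weight at most `δ`. -/
theorem ofReal_one_sub_le_measure {K T : ℕ} {η γ : ℕ → ℝ} {d : ℕ → ℕ} {ℓ : ℕ → Fin K → ℝ}
    {Ω : Type*} [MeasurableSpace Ω] {μ : Measure Ω} [IsProbabilityMeasure μ] {A : ℕ → Ω → Fin K}
    (hA : IsDAdaExp3 T η γ d ℓ μ A) (i₀ : Fin K) {δ : ℝ} (hδ : 0 ≤ δ) {S : Set Ω}
    (G : (Finset.Icc 1 T → Fin K) → Prop) [DecidablePred G]
    (hG : ∀ ω, G (fun t => A t ω) → ω ∈ S)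
    (hsum : ∑ a : Finset.Icc 1 T → Fin K, (if G a then 0 else
      ∏ t : Finset.Icc 1 T, prob η γ d ℓ (extend i₀ a) t (a t)) ≤ δ) :
    ENNReal.ofReal (1 - δ) ≤ μ S := by
  let E : (Finset.Icc 1 T → Fin K) → Set Ω := fun a =>
    {ω | ∀ s ∈ Finset.Icc 1 T, A s ω = extend i₀ a s}
  have hE : ∀ a, μ (E a) = ENNReal.ofReal
      (∏ t : Finset.Icc 1 T, prob η γ d ℓ (extend i₀ a) t (a t)) := by
    intro a
    rw [measure_actions_eq hA (extend i₀ a) le_rfl, ← Finset.prod_coe_sort (Finset.Icc 1 T)]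
    simp only [extend_coe]
  let B := Finset.univ.filter fun a : Finset.Icc 1 T → Fin K => ¬ G a
  -- Only monotonicity and subadditivity of `μ` are applied to this cover, so `S` need not be
  -- measurable.
  have hcover : (Set.univ : Set Ω) ⊆ S ∪ ⋃ a ∈ B, E a := by
    intro ω _
    by_cases h : G (fun t => A t ω)
    · exact Or.inl (hG ω h)
    · refine Or.inr (Set.mem_biUnion (x := fun t : Finset.Icc 1 T => A t ω) ?_ ?_)
      · simpa [B] using h
      · intro s hs
        simp [extend, hs]
  have h1 : (1 : ENNReal) ≤ μ S + ENNReal.ofReal δ := by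
    calc (1 : ENNReal) = μ Set.univ := measure_univ.symm
      _ ≤ μ (S ∪ ⋃ a ∈ B, E a) := measure_mono hcover
      _ ≤ μ S + μ (⋃ a ∈ B, E a) := measure_union_le _ _
      _ ≤ μ S + ∑ a ∈ B, μ (E a) := by
        gcongr
        exact measure_biUnion_finset_le _ _
      _ ≤ μ S + ENNReal.ofReal δ := by
        gcongr
        simp only [hE]
        rw [← ENNReal.ofReal_sum_of_nonneg fun a _ =>
          Finset.prod_nonneg fun t _ => prob_nonneg _ _ _ _ _ _ _]
        refine ENNReal.ofReal_le_ofReal (le_trans (le_of_eq ?_) hsum)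
        simp only [B, Finset.sum_filter]
        refine Finset.sum_congr rfl fun a _ => ?_
        split_ifs <;> simp_all
  rw [ENNReal.ofReal_sub _ hδ, ENNReal.ofReal_one]
  exact tsub_le_iff_right.2 h1

/-! ### Assembly of the regret bound on the good event. -/

section Regret

variable {K T : ℕ} (hK : 2 ≤ K) (d : ℕ → ℕ) (ℓ : ℕ → Fin K → ℝ)

include hK

/-- Decomposition of the regret along a fixed sequence of actions. -/
theorem regret_le (hT : 1 ≤ T) (a : ℕ → Fin K) (i : Fin K) :
    ∑ t ∈ Finset.Icc 1 T, (ℓ t (a t) - ℓ t i) ≤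
      ∑ t ∈ Finset.Icc 1 T, roundExcess (stepSize K d) d ℓ a t +
        Real.log K / stepSize K d T +
        ∑ t ∈ Finset.Icc 1 T,
          (lossEst (stepSize K d) (stepSize K d) d ℓ a t i - ℓ t i) := by
  have : Nonempty (Fin K) := ⟨i⟩
  set η := stepSize K d with hη
  have h1 := sum_potential_sub_le hT (η := η) (fun t ht => stepSize_pos hK d ht)
    (fun t ht => stepSize_anti hK d ht (Nat.le_succ t)) (fun t => cumEst η η d ℓ a t)
    (by funext j; simp [cumEst])
  have h2 := potential_le (stepSize_pos hK d hT) (cumEst η η d ℓ a (T + 1)) i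
  rw [Fintype.card_fin, ← hη] at h2
  have h3 : cumEst η η d ℓ a (T + 1) i = ∑ t ∈ Finset.Icc 1 T, lossEst η η d ℓ a t i := rfl
  simp only [roundExcess, Finset.sum_sub_distrib] at h1 ⊢
  linarith

/-- The regret bound on the event where the two concentration inequalities hold. -/
theorem regret_le_of_concentration (hT : 1 ≤ T) (a : ℕ → Fin K) (i : Fin K) {x : ℝ} (hx : 0 ≤ x)
    (hcomp : 2 * stepSize K d T * ∑ t ∈ Finset.Icc 1 T,
      (lossEst (stepSize K d) (stepSize K d) d ℓ a t i - ℓ t i) ≤ Real.log K + x)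
    (hexc : 2 / (maxDelay T d + 2) * ∑ t ∈ Finset.Icc 1 T, roundExcess (stepSize K d) d ℓ a t ≤
      2 / (maxDelay T d + 2) *
        ∑ t ∈ Finset.Icc 1 T, stepSize K d t * (2 * K + numMissing d t) + x) :
    ∑ t ∈ Finset.Icc 1 T, (ℓ t (a t) - ℓ t i) ≤
      2 * √(3 * Real.log K * (2 * K * T + cumDelay T d)) +
        (2 * √((2 * T * K + cumDelay T d) / (3 * Real.log K)) + maxDelay T d + 2) * (x / 2) := by
  have hlog := log_card_pos hK
  have hη := stepSize_pos hK d hT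
  have hA := stepDenom_pos hK d hT
  have hAD := stepDenom_le d K T
  have hreg := regret_le hK d ℓ hT a i
  have hsum := sum_stepSize_mul_le hK d T
  rw [← Real.sqrt_mul (by positivity)] at hsum
  set Y := ∑ t ∈ Finset.Icc 1 T,
    (lossEst (stepSize K d) (stepSize K d) d ℓ a t i - ℓ t i)
  set X := ∑ t ∈ Finset.Icc 1 T, roundExcess (stepSize K d) d ℓ a t
  set S := ∑ t ∈ Finset.Icc 1 T, stepSize K d t * (2 * K + numMissing d t)
  set W := stepDenom K d T with hW
  have hX : X ≤ S + (maxDelay T d + 2) * (x / 2) := by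
    have h0 : (0 : ℝ) < maxDelay T d + 2 := by positivity
    have := mul_le_mul_of_nonneg_left hexc (show (0 : ℝ) ≤ (maxDelay T d + 2) / 2 by positivity)
    field_simp at this
    linarith
  set ρ := √(W / (3 * Real.log K)) with hρ
  have hinv : 1 / stepSize K d T = 2 * ρ := by
    rw [stepSize_eq hK, hρ, Real.sqrt_div hA.le, ← hW, one_div_div]
    ring
  have hη1 : stepSize K d T * (2 * ρ) = 1 := by
    rw [← hinv]; field_simp
  have hρ0 : 0 ≤ ρ := Real.sqrt_nonneg _
  have hY : Y ≤ (Real.log K + x) * ρ := by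
    calc Y = 2 * stepSize K d T * Y * ρ := by linear_combination (-Y) * hη1
      _ ≤ _ := mul_le_mul_of_nonneg_right hcomp hρ0
  have hlogη : Real.log K / stepSize K d T = 2 * Real.log K * ρ := by
    rw [← mul_one_div, hinv]; ring
  -- Of the three copies of `log K * ρ`, two come from `log K / η_T` and one from the union bound
  -- over actions; the `3` in the step size balances them against `S`.
  have hρlog : 3 * Real.log K * ρ = √(3 * Real.log K * W) := by
    rw [hρ, Real.sqrt_div hA.le, Real.sqrt_mul (show 0 ≤ 3 * Real.log K by positivity) W]
    have h2 := Real.mul_self_sqrt (show 0 ≤ 3 * Real.log K by positivity)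
    have h3 : 0 < √(3 * Real.log K) := Real.sqrt_pos.2 (by positivity)
    field_simp
    linear_combination (-1 : ℝ) * h2
  have hbig : √(3 * Real.log K * W) ≤ √(3 * Real.log K * (2 * K * T + cumDelay T d)) :=
    Real.sqrt_le_sqrt (mul_le_mul_of_nonneg_left (by linarith) (by positivity))
  have hρbig : ρ ≤ √((2 * T * K + cumDelay T d) / (3 * Real.log K)) :=
    Real.sqrt_le_sqrt (div_le_div_of_nonneg_right hAD (by positivity))
  have := mul_le_mul_of_nonneg_left hρbig hx
  linarith

end Regret

end DelayedBandit

theorem mainTheorem4 {K T : ℕ} (hK : 2 ≤ K)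
    (ℓ : ℕ → Fin K → ℝ) (hℓ : ∀ t ∈ Finset.Icc 1 T, ∀ i, ℓ t i ∈ Set.Icc (0 : ℝ) 1)
    (d : ℕ → ℕ) (hd : ∀ t ∈ Finset.Icc 1 T, t + d t ≤ T)
    {Ω : Type*} [MeasurableSpace Ω] (μ : MeasureTheory.Measure Ω)
    [MeasureTheory.IsProbabilityMeasure μ] (A : ℕ → Ω → Fin K)
    (hA : DelayedBandit.IsDAdaExp3 T (DelayedBandit.stepSize K d) (DelayedBandit.stepSize K d)
      d ℓ μ A)
    (δ : ℝ) (hδ0 : 0 < δ) (hδ1 : δ < 1) :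
    ENNReal.ofReal (1 - δ) ≤
      μ {ω | ∀ i : Fin K,
        ∑ t ∈ Finset.Icc 1 T, (ℓ t (A t ω) - ℓ t i) ≤
          2 * √(3 * Real.log K * (2 * K * T + DelayedBandit.cumDelay T d)) +
          (2 * √((2 * T * K + DelayedBandit.cumDelay T d) / (3 * Real.log K)) +
            DelayedBandit.maxDelay T d + 2) * (Real.log (2 / δ) / 2)} := by
  classical
  have hx : 0 ≤ Real.log (2 / δ) := Real.log_nonneg (by rw [le_div_iff₀ hδ0]; linarith)
  -- For `T = 0` the final step size is `0` by the convention for division, so this case is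
  -- separate.
  rcases Nat.eq_zero_or_pos T with rfl | hT
  · have huniv : {ω | ∀ i : Fin K,
        ∑ t ∈ Finset.Icc 1 0, (ℓ t (A t ω) - ℓ t i) ≤
          2 * √(3 * Real.log K * (2 * K * (0 : ℕ) + DelayedBandit.cumDelay 0 d)) +
          (2 * √((2 * (0 : ℕ) * K + DelayedBandit.cumDelay 0 d) / (3 * Real.log K)) +
            DelayedBandit.maxDelay 0 d + 2) * (Real.log (2 / δ) / 2)} = Set.univ := by
      refine Set.eq_univ_of_forall fun ω i => ?_
      rw [Finset.Icc_eq_empty (by norm_num), Finset.sum_empty]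
      positivity
    rw [huniv, MeasureTheory.measure_univ]
    exact ENNReal.ofReal_le_one.2 (by linarith)
  let i₀ : Fin K := ⟨0, by omega⟩
  set η := DelayedBandit.stepSize K d with hη
  set x := Real.log (2 / δ) with hxdef
  set lam : ℝ := 2 / (DelayedBandit.maxDelay T d + 2) with hlam
  set S := ∑ t ∈ Finset.Icc 1 T, η t * (2 * K + DelayedBandit.numMissing d t) with hS
  have hηpos : ∀ t, 1 ≤ t → 0 < η t := fun t ht => DelayedBandit.stepSize_pos hK d ht
  have hηT := hηpos T hT
  let Y : Fin K → (ℕ → Fin K) → ℝ := fun i a =>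
    ∑ t ∈ Finset.Icc 1 T, (DelayedBandit.lossEst η η d ℓ a t i - ℓ t i)
  let X : (ℕ → Fin K) → ℝ := fun a => ∑ t ∈ Finset.Icc 1 T, DelayedBandit.roundExcess η d ℓ a t
  let w : (Finset.Icc 1 T → Fin K) → ℝ := fun a =>
    ∏ t : Finset.Icc 1 T, DelayedBandit.prob η η d ℓ (DelayedBandit.extend i₀ a) t (a t)
  have hw : ∀ a, 0 ≤ w a := fun a =>
    Finset.prod_nonneg fun t _ => DelayedBandit.prob_nonneg _ _ _ _ _ _ _
  let G : (Finset.Icc 1 T → Fin K) → Prop := fun a =>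
    (∀ i, 2 * η T * Y i (DelayedBandit.extend i₀ a) ≤ Real.log K + x) ∧
      lam * X (DelayedBandit.extend i₀ a) ≤ lam * S + x
  have hmY : ∀ i, ∑ a, w a * Real.exp (2 * η T * Y i (DelayedBandit.extend i₀ a)) ≤ 1 := by
    intro i
    refine le_trans (le_of_eq (Finset.sum_congr rfl fun a _ => ?_))
      (DelayedBandit.sum_prod_exp_lossEst_le hK d ℓ hℓ i₀ i hηpos (c := 2 * η T) (by positivity)
        fun t ht => ?_)
    · rw [Finset.prod_mul_distrib, ← Real.exp_sum, ← Finset.mul_sum,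
        Finset.sum_coe_sort (Finset.Icc 1 T) (fun t => DelayedBandit.lossEst η η d ℓ
          (DelayedBandit.extend i₀ a) t i - ℓ t i)]
    · have := Finset.mem_Icc.1 ht
      have := DelayedBandit.stepSize_anti hK d this.1 this.2
      linarith
  have hmX : ∑ a, w a * Real.exp (lam * X (DelayedBandit.extend i₀ a)) ≤ Real.exp (lam * S) := by
    refine le_trans (le_of_eq (Finset.sum_congr rfl fun a _ => ?_))
      (DelayedBandit.sum_prod_exp_roundExcess_le hK d ℓ hℓ i₀)
    rw [Finset.prod_mul_distrib, ← Real.exp_sum, ← Finset.mul_sum,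
      Finset.sum_coe_sort (Finset.Icc 1 T) (fun t => DelayedBandit.roundExcess η d ℓ
        (DelayedBandit.extend i₀ a) t)]
  have hK0 : (0 : ℝ) < K := by exact_mod_cast (by omega : 0 < K)
  have hex : Real.exp (-x) = δ / 2 := by
    rw [Real.exp_neg, hxdef, Real.exp_log (by positivity), inv_div]
  refine DelayedBandit.ofReal_one_sub_le_measure hA i₀ hδ0.le G ?_ ?_
  · intro ω hG i
    have hext : ∀ t ∈ Finset.Icc 1 T,
        DelayedBandit.extend i₀ (fun t : Finset.Icc 1 T => A t ω) t = A t ω := fun t ht => by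
      simp [DelayedBandit.extend, ht]
    have h := DelayedBandit.regret_le_of_concentration hK d ℓ hT _ i hx (hG.1 i) hG.2
    rwa [Finset.sum_congr rfl fun t ht => by rw [hext t ht]] at h
  -- Markov's inequality and the union bound, pointwise: each violated condition makes its own term
  -- at least `w a`. Each action is allotted `δ / 2 / K` and the excess `δ / 2`.
  · have hbad : ∀ a, (if G a then 0 else w a) ≤
        ∑ i, w a * Real.exp (2 * η T * Y i (DelayedBandit.extend i₀ a)) * (δ / 2 / K) +
          w a * Real.exp (lam * X (DelayedBandit.extend i₀ a)) *
            (Real.exp (-(lam * S)) * (δ / 2)) := by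
      intro a
      have hpos : ∀ i, 0 ≤ w a * Real.exp (2 * η T * Y i (DelayedBandit.extend i₀ a)) *
          (δ / 2 / K) := fun i => mul_nonneg (mul_nonneg (hw a) (Real.exp_pos _).le) (by positivity)
      have hpos' : 0 ≤ w a * Real.exp (lam * X (DelayedBandit.extend i₀ a)) *
          (Real.exp (-(lam * S)) * (δ / 2)) :=
        mul_nonneg (mul_nonneg (hw a) (Real.exp_pos _).le) (by positivity)
      split_ifs with hG
      · exact add_nonneg (Finset.sum_nonneg fun i _ => hpos i) hpos'
      rcases not_and_or.1 hG with h | h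
      · obtain ⟨i, hi⟩ := not_forall.1 h
        have h1 : 1 ≤ Real.exp (2 * η T * Y i (DelayedBandit.extend i₀ a)) * (δ / 2 / K) := by
          rw [← hex, div_eq_mul_inv, ← Real.exp_log (inv_pos.2 hK0), Real.log_inv, ← Real.exp_add,
            ← Real.exp_add]
          exact Real.one_le_exp (by linarith [not_le.1 hi])
        have h2 := Finset.single_le_sum (fun i _ => hpos i) (Finset.mem_univ i)
        have h3 := mul_le_mul_of_nonneg_left h1 (hw a)
        linarith
      · have h1 : 1 ≤ Real.exp (lam * X (DelayedBandit.extend i₀ a)) *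
            (Real.exp (-(lam * S)) * (δ / 2)) := by
          rw [← hex, ← Real.exp_add, ← Real.exp_add]
          exact Real.one_le_exp (by linarith [not_le.1 h])
        have h2 := Finset.sum_nonneg fun i (_ : i ∈ Finset.univ) => hpos i
        have h3 := mul_le_mul_of_nonneg_left h1 (hw a)
        linarith
    refine (Finset.sum_le_sum fun a _ => hbad a).trans ?_
    rw [Finset.sum_add_distrib, Finset.sum_comm, ← Finset.sum_mul]
    have h1 : ∑ i, ∑ a, w a * Real.exp (2 * η T * Y i (DelayedBandit.extend i₀ a)) *
        (δ / 2 / K) ≤ ∑ _i : Fin K, δ / 2 / K := by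
      refine Finset.sum_le_sum fun i _ => ?_
      rw [← Finset.sum_mul]
      exact mul_le_of_le_one_left (by positivity) (hmY i)
    have h2 : ∑ _i : Fin K, δ / 2 / (K : ℝ) = δ / 2 := by
      rw [Finset.sum_const, Finset.card_univ, Fintype.card_fin, nsmul_eq_mul]
      field_simp
    have h3 := mul_le_mul_of_nonneg_right hmX
      (show 0 ≤ Real.exp (-(lam * S)) * (δ / 2) by positivity)
    rw [← mul_assoc (Real.exp (lam * S)), ← Real.exp_add, add_neg_cancel, Real.exp_zero,
      one_mul] at h3
    linarith
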